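/- Let $G$ be a connected noncompact simple real Lie group with trivial center and $K\subset G$ a maximal compact subgroup whose center has positive dimension. Let $\mathfrak g=\mathfrak k\oplus\mathfrak p$, where $\mathfrak k=\mathrm{Lie}(K)$ and $\mathfrak p$ is the orthogonal complement of $\mathfrak k$ for the Killing form (equivalently, the sum of the nontrivial isotypical components of $\mathfrak g$ for the adjoint action of the center of $K$), and let $\psi:\mathfrak g\to\mathfrak p$ be the projection along $\mathfrak k$. Equip $K\backslash G$ with a complex structure, compatible with its quotient smooth structure, for which $G$ acts by holomorphic maps, so that it is a Hermitian symmetric space. Let $\Gamma\subset G$ be a discrete torsionfree subgroup and give $M_\Gamma=K\backslash G/\Gamma$ the induced structure of a complex manifold. Let $X$ be a compact connected complex manifold, $\beta:\widetilde X\to X$ its universal cover associated to a base point $x_0$, with the right action of $\pi_1(X,x_0)$, and $\rho:\pi_1(X,x_0)\to\Gamma$ a homomorphism such that the adjoint action of $\rho(\pi_1(X,x_0))$ on $\mathfrak g$ is completely reducible. Let $E_G=(\widetilde X\times G)/\big((x,g)\sim(x\cdot z,\rho(z)^{-1}g)\big)$ be the flat principal $G$-bundle on $X$ given by $\rho$,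 with the flat connection $D$ induced by the Maurer–Cartan form of $G$, and let $E_K\subset E_G$ be any $C^\infty$ reduction of structure group to $K$. It is given by the equivariant map $h:\widetilde X\to G/K$, $h(x)=\{g : [x,g]\in E_K\}$, and composing $h$ with $gK\mapsto Kg^{-1}$ and descending to $X$ gives a map $H_D:X\to M_\Gamma$. Similarly let $\mathcal E_G=\big((K\backslash G)\times G\big)/\big((m,g)\sim(m\gamma^{-1},\gamma g),\ \gamma\in\Gamma\big)$ be the universal flat $G$-bundle on $M_\Gamma$, with the flat connection $\mathcal D^0$ induced by the Maurer–Cartan form of $G$ and the reduction $\mathcal E_K=\{[Kg^{-1},g] : g\in G\}$ to $K$. The map $E_K\to\mathcal E_K$, $[x,g]\mapsto[Kg^{-1},g]$, identifies $E_K$ with $H_D^*\mathcal E_K$, hence the bundle $E_K(\mathfrak p)=E_K\times^K\mathfrak p$ with $H_D^*\mathcal E_K(\mathfrak p)$. For a flat principal $G$-bundle with connection form $D$ and reduction $F_K$ to $K$ over a complex manifold $Y$, the form $\psi\circ D|_{F_K}$ descends to an $F_K(\mathfrak p)$-valued $1$-form on $Y$; let $D^{1,0}+D^{0,1}$ be its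 decomposition into types and put $\omega=\frac{1}{\sqrt{-1}}(D^{1,0}-D^{0,1})$. Let $\omega_D$ be the form obtained from $(D,E_K)$ on $X$ and $\omega_{\mathcal D^0}$ the form obtained from $(\mathcal D^0,\mathcal E_K)$ on $M_\Gamma$, and let $\widetilde{H_D^*\omega_{\mathcal D^0}}$ be the $E_K(\mathfrak p)$-valued $1$-form on $X$ obtained by pulling back $\omega_{\mathcal D^0}$, using the differential $dH_D$ and the identification $H_D^*\mathcal E_K(\mathfrak p)= E_K(\mathfrak p)$. Then $H_D$ is holomorphic if and only if $\widetilde{H_D^*\omega_{\mathcal D^0}}=\omega_D$, and $H_D$ is anti-holomorphic if and only if $\widetilde{H_D^*\omega_{\mathcal D^0}}=-\omega_D$. -/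

import Mathlib

open scoped Manifold ContDiff TensorProduct Topology

noncomputable section

namespace FlatReduction

set_option linter.unusedSectionVars false

/-! ### The Lie group, its maximal compact subgroup and the decomposition `𝔤 = 𝔨 ⊕ 𝔭` -/

section LieTheory

variable (E : Type*) [NormedAddCommGroup E] [NormedSpace ℝ E]
  {G : Type*} [TopologicalSpace G] [ChartedSpace E G] [Group G]

/-- The Lie algebra of a closed subgroup `S` of a Lie group `G`, as a subspace of the Lie algebra
of `G`: it consists of the velocities at `t = 0` of the smooth curves in `S` with `c 0 = 1`.
(For closed `S` these velocities form a linear subspace; the span only provides the bundling.) -/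
def lieSubspace (S : Subgroup G) : Submodule ℝ (GroupLieAlgebra 𝓘(ℝ, E) G) :=
  Submodule.span ℝ {v | ∃ c : ℝ → G, c 0 = 1 ∧ ContMDiffAt 𝓘(ℝ, ℝ) 𝓘(ℝ, E) ∞ c 0 ∧
    (∀ᶠ t in 𝓝 (0 : ℝ), c t ∈ S) ∧ (mfderiv 𝓘(ℝ, ℝ) 𝓘(ℝ, E) c 0 : ℝ →L[ℝ] E) 1 = v}

/-- The adjoint action of `g` on the Lie algebra: the differential at `1` of `h ↦ g h g⁻¹`. -/
def Ad (g : G) : GroupLieAlgebra 𝓘(ℝ, E) G →ₗ[ℝ] GroupLieAlgebra 𝓘(ℝ, E) G :=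
  (mfderiv 𝓘(ℝ, E) 𝓘(ℝ, E) (fun h : G => g * h * g⁻¹) 1 : E →L[ℝ] E).toLinearMap

/-- The left invariant Maurer--Cartan form of `G` at `g`: left translation by `g⁻¹`. -/
def maurerCartan (g : G) : TangentSpace 𝓘(ℝ, E) g →L[ℝ] GroupLieAlgebra 𝓘(ℝ, E) G :=
  (mfderiv 𝓘(ℝ, E) 𝓘(ℝ, E) (fun h : G => g⁻¹ * h) g : E →L[ℝ] E)

/-- The adjoint action of the subgroup `S` on the Lie algebra is completely reducible:
every invariant subspace has an invariant complement. -/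
def AdCompletelyReducible (S : Subgroup G) : Prop :=
  ∀ W : Submodule ℝ (GroupLieAlgebra 𝓘(ℝ, E) G), (∀ g ∈ S, W.map (Ad E g) ≤ W) →
    ∃ W' : Submodule ℝ (GroupLieAlgebra 𝓘(ℝ, E) G),
      (∀ g ∈ S, W'.map (Ad E g) ≤ W') ∧ IsCompl W W'

variable [CompleteSpace E] [LieGroup 𝓘(ℝ, E) ∞ G]

instance instLieGroupMinSmoothness : LieGroup 𝓘(ℝ, E) (minSmoothness ℝ 3) G :=
  LieGroup.of_le (n := ∞) (by
    rw [minSmoothness_of_isRCLikeNormedField]; exact ENat.LEInfty.out)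

/-- The subspace `𝔭` of the Cartan decomposition `𝔤 = 𝔨 ⊕ 𝔭`: the orthogonal complement of
`𝔨 = Lie K` for the Killing form. (As `K` contains its center `Z` and `𝔨` is the fixed space of
`Ad Z`, this is the sum of the nontrivial isotypical components of `𝔤` under `Ad Z`.) -/
def cartanP (K : Subgroup G) : Submodule ℝ (GroupLieAlgebra 𝓘(ℝ, E) G) :=
  (killingForm ℝ (GroupLieAlgebra 𝓘(ℝ, E) G)).orthogonal (lieSubspace E K)

open Classical in
/-- The projection `ψ : 𝔤 → 𝔭` along `𝔨`. (The two subspaces are complementary when `G` is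
semisimple and `K` compact, the Killing form being negative definite on `𝔨`.) -/
def projP (K : Subgroup G) : GroupLieAlgebra 𝓘(ℝ, E) G →ₗ[ℝ] cartanP E K :=
  if h : IsCompl (cartanP E K) (lieSubspace E K) then Submodule.projectionOnto _ _ h else 0

end LieTheory

/-! ### The spaces `K\G` and `M_Γ = K\G/Γ` -/

section Spaces

variable {G : Type*} [Group G]

/-- The space `K\G` of cosets `K g`. -/
def RightCosets (K : Subgroup G) : Type _ := Quotient (QuotientGroup.rightRel K)

/-- The coset `K g`. -/
def RightCosets.mk (K : Subgroup G) (g : G) : RightCosets K :=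
  Quotient.mk (QuotientGroup.rightRel K) g

/-- `G` acts on the right of `K\G` by `(K g) · a = K (g a)`. -/
instance (K : Subgroup G) : MulAction Gᵐᵒᵖ (RightCosets K) where
  smul a := Quotient.map (fun g => g * a.unop) (by
    intro g g' h
    have h := QuotientGroup.rightRel_apply.1 h
    refine QuotientGroup.rightRel_apply.2 ?_
    simpa [mul_assoc] using h)
  one_smul := by
    rintro ⟨g⟩
    exact congrArg (RightCosets.mk K) (mul_one g)
  mul_smul := by
    rintro a b ⟨g⟩
    exact congrArg (RightCosets.mk K) (mul_assoc g b.unop a.unop).symm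

/-- The restriction to a subgroup `Γ` of the right action of `G` on `K\G`. -/
instance (K Γ : Subgroup G) : MulAction (↥Γ)ᵐᵒᵖ (RightCosets K) :=
  MulAction.compHom (RightCosets K) (MonoidHom.op Γ.subtype)

lemma RightCosets.smul_mk (K : Subgroup G) (a : Gᵐᵒᵖ) (g : G) :
    a • RightCosets.mk K g = RightCosets.mk K (g * a.unop) := rfl

lemma RightCosets.smul_mk' (K Γ : Subgroup G) (a : (↥Γ)ᵐᵒᵖ) (g : G) :
    a • RightCosets.mk K g = RightCosets.mk K (g * (a.unop : G)) := rfl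

lemma RightCosets.mk_eq_iff (K : Subgroup G) (g g' : G) :
    RightCosets.mk K g = RightCosets.mk K g' ↔ ∃ k ∈ K, g' = k * g := by
  refine (Quotient.eq (r := QuotientGroup.rightRel K)).trans
    (QuotientGroup.rightRel_apply.trans ?_)
  constructor
  · intro h
    exact ⟨_, h, by group⟩
  · rintro ⟨k, hk, rfl⟩
    simpa using hk

/-- The isomorphism `ι : G/K → K\G`, `g K ↦ K g⁻¹`. -/
def cosetInv (K : Subgroup G) : G ⧸ K → RightCosets K :=
  Quotient.map' (fun g => g⁻¹) (by
    intro g g' h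
    have h := QuotientGroup.leftRel_apply.1 h
    refine QuotientGroup.rightRel_apply.2 ?_
    simpa using K.inv_mem h)

lemma cosetInv_mk (K : Subgroup G) (g : G) :
    cosetInv K (QuotientGroup.mk g) = RightCosets.mk K g⁻¹ := rfl

/-- The double coset space `M_Γ = (K\G)/Γ`. -/
def DoubleCosets (K Γ : Subgroup G) : Type _ :=
  MulAction.orbitRel.Quotient (↥Γ)ᵐᵒᵖ (RightCosets K)

/-- The projection `K\G → K\G/Γ`. -/
def DoubleCosets.mk (K Γ : Subgroup G) (m : RightCosets K) : DoubleCosets K Γ :=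
  Quotient.mk (MulAction.orbitRel (↥Γ)ᵐᵒᵖ (RightCosets K)) m

variable [TopologicalSpace G]

instance (K : Subgroup G) : TopologicalSpace (RightCosets K) :=
  inferInstanceAs (TopologicalSpace (Quotient (QuotientGroup.rightRel K)))

instance (K Γ : Subgroup G) : TopologicalSpace (DoubleCosets K Γ) :=
  inferInstanceAs (TopologicalSpace (Quotient (MulAction.orbitRel (↥Γ)ᵐᵒᵖ (RightCosets K))))

end Spaces

/-- A group without elements of finite order other than `1`. -/
class TorsionFree (Λ : Type*) [Group Λ] : Prop where
  eq_one_of_isOfFinOrder : ∀ γ : Λ, IsOfFinOrder γ → γ = 1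

section Covering

variable {G : Type*} [Group G] [TopologicalSpace G] [IsTopologicalGroup G] [T2Space G]

lemma isOpenQuotientMap_rightCosets (K : Subgroup G) : IsOpenQuotientMap (RightCosets.mk K) := by
  have : IsOpenQuotientMap (Quotient.mk (MulAction.orbitRel K G)) :=
    MulAction.isOpenQuotientMap_quotientMk
  exact this

/-- The discrete torsionfree group `Γ` acts on `K\G` by deck transformations over `K\G/Γ`. -/
theorem isQuotientCoveringMap_doubleCosets (K Γ : Subgroup G) [CompactSpace K]
    [DiscreteTopology Γ] [TorsionFree Γ] :
    IsQuotientCoveringMap (DoubleCosets.mk K Γ) (↥Γ)ᵐᵒᵖ where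
  toIsQuotientMap := isQuotientMap_quot_mk
  continuous_const_smul := by
    intro a
    refine (isOpenQuotientMap_rightCosets K).isQuotientMap.continuous_iff.2 ?_
    have : Continuous fun g : G => RightCosets.mk K (g * (a.unop : G)) :=
      (isOpenQuotientMap_rightCosets K).continuous.comp (continuous_mul_const _)
    exact this
  apply_eq_iff_mem_orbit := by
    intro e₁ e₂
    exact Quotient.eq.trans MulAction.orbitRel_apply
  disjoint := by
    intro m
    obtain ⟨g, rfl⟩ := (isOpenQuotientMap_rightCosets K).surjective m
    have hKc : IsCompact (K : Set G) := isCompact_iff_compactSpace.2 inferInstance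
    have hΓ : IsClosed (Γ : Set G) := Subgroup.isClosed_of_discrete
    have hC : IsClosed (Subtype.val '' ({1}ᶜ : Set Γ)) :=
      hΓ.isClosedMap_subtype_val _ (isClosed_discrete _)
    -- the stabilizer of `K g` in `Γ` is a compact discrete group, hence finite, hence trivial
    have hstab : ∀ k ∈ K, g⁻¹ * k * g ∉ Subtype.val '' ({1}ᶜ : Set Γ) := by
      rintro k hk ⟨γ, hγ1, hγ⟩
      refine hγ1 (TorsionFree.eq_one_of_isOfFinOrder γ ?_)
      have hcpt : IsCompact ((fun k : G => g⁻¹ * k * g) '' (K : Set G)) :=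
        hKc.image (by fun_prop)
      have hfin : ((Subtype.val : Γ → G) ⁻¹' ((fun k : G => g⁻¹ * k * g) '' (K : Set G))).Finite :=
        (hΓ.isClosedEmbedding_subtypeVal.isCompact_preimage hcpt).finite_of_discrete
      by_contra hord
      have hinj := injective_pow_iff_not_isOfFinOrder.2 hord
      refine Set.infinite_range_of_injective hinj (hfin.subset ?_)
      rintro _ ⟨n, rfl⟩
      refine ⟨k ^ n, K.pow_mem hk n, ?_⟩
      have := conj_pow (a := g⁻¹) (b := k) (i := n)
      simp only [inv_inv] at this
      simp [← this, hγ]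
    have hopen : IsOpen {q : (G × G) × G | q.1.1⁻¹ * q.2 * q.1.2 ∉ Subtype.val '' ({1}ᶜ : Set Γ)} :=
      hC.isOpen_compl.preimage (by fun_prop)
    obtain ⟨U, V, hU, -, hgU, hKV, hUV⟩ := generalized_tube_lemma
      (isCompact_singleton (x := (g, g))) hKc hopen (by
        rintro ⟨⟨a, b⟩, k⟩ ⟨hab, hk⟩
        obtain ⟨rfl, rfl⟩ := Prod.mk.inj (Set.mem_singleton_iff.1 hab)
        exact hstab k hk)
    obtain ⟨U₁, hU₁, U₂, hU₂, hUU⟩ :=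
      mem_nhds_prod_iff.1 (hU.mem_nhds (hgU (Set.mem_singleton _)))
    refine ⟨RightCosets.mk K '' (U₁ ∩ U₂),
      (isOpenQuotientMap_rightCosets K).isOpenMap.image_mem_nhds (Filter.inter_mem hU₁ hU₂), ?_⟩
    rintro a ⟨_, ⟨_, ⟨u, hu, rfl⟩, rfl⟩, u', hu', hEq⟩
    obtain ⟨k, hk, hkeq⟩ := (RightCosets.mk_eq_iff K _ _).1
      (hEq.trans (RightCosets.smul_mk' K Γ a u))
    have hmem := hUV (Set.mk_mem_prod (hUU (Set.mk_mem_prod hu.1 hu'.2)) (hKV hk))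
    have hval : (a.unop : G) = u⁻¹ * k * u' := by
      rw [mul_assoc, ← hkeq]; group
    by_contra hne
    refine hmem ⟨a.unop, ?_, hval⟩
    simpa using hne

end Covering

/-! ### Flat principal bundles -/

section FlatBundle

variable {Λ A Y G : Type*} [Group Λ] [TopologicalSpace A] [MulAction Λᵐᵒᵖ A] [TopologicalSpace Y]
  [Group G] {p : A → Y}

/-- The relation on `A × G`: `(x₁, g₁)` and `(x₂, g₂)` are identified if `x₂ = x₁ · z` and
`g₂ = ρ(z)⁻¹ g₁` for some `z`. Right actions are actions of the opposite group. -/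
def flatSetoid (A : Type*) [MulAction Λᵐᵒᵖ A] (ρ : Λ →* G) : Setoid (A × G) where
  r a b := ∃ z : Λ, b.1 = MulOpposite.op z • a.1 ∧ b.2 = (ρ z)⁻¹ * a.2
  iseqv :=
    { refl := fun a => ⟨1, by simp, by simp⟩
      symm := by
        rintro ⟨x, g⟩ ⟨x', g'⟩ ⟨z, hx, hg⟩
        refine ⟨z⁻¹, ?_, ?_⟩
        · simp only at hx
          simp [hx]
        · simp only at hg
          simp [hg]
      trans := by
        rintro ⟨x, g⟩ ⟨x', g'⟩ ⟨x'', g''⟩ ⟨z, hx, hg⟩ ⟨w, hx', hg'⟩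
        refine ⟨z * w, ?_, ?_⟩
        · simp only at hx hx'
          rw [hx', hx, MulOpposite.op_mul, mul_smul]
        · simp only at hg hg'
          simp [hg', hg, mul_assoc] }

/-- The flat principal `G`-bundle on `Y` attached to a covering `p : A → Y` with deck group `Λ`
(acting on the right) and a homomorphism `ρ : Λ → G`: the quotient `(A × G) / Λ`. -/
def FlatBundle (_hp : IsQuotientCoveringMap p Λᵐᵒᵖ) (ρ : Λ →* G) : Type _ :=
  Quotient (flatSetoid A ρ)

namespace FlatBundle

variable (hp : IsQuotientCoveringMap p Λᵐᵒᵖ) (ρ : Λ →* G)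

/-- The quotient map `A × G → (A × G) / Λ`. -/
def mk (a : A × G) : FlatBundle hp ρ := Quotient.mk (flatSetoid A ρ) a

/-- A representative of a point of the bundle. -/
def out (z : FlatBundle hp ρ) : A × G := Quotient.out (s := flatSetoid A ρ) z

/-- The bundle projection, `[x, g] ↦ p x`. -/
def proj : FlatBundle hp ρ → Y :=
  Quotient.lift (fun a => p a.1) (by
    rintro ⟨x, g⟩ ⟨x', g'⟩ ⟨z, hx, -⟩
    simp only at hx
    simp only [hx, hp.map_smul])

/-- The right action of `G` on the bundle, `[x, g] · a = [x, g a]`. -/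
def act (a : G) : FlatBundle hp ρ → FlatBundle hp ρ :=
  Quotient.map (fun b => (b.1, b.2 * a)) (by
    rintro ⟨x, g⟩ ⟨x', g'⟩ ⟨z, hx, hg⟩
    simp only at hx hg
    exact ⟨z, hx, by simp [hg, mul_assoc]⟩)

lemma mk_eq_iff (a b : A × G) : mk hp ρ a = mk hp ρ b ↔
    ∃ z : Λ, b.1 = MulOpposite.op z • a.1 ∧ b.2 = (ρ z)⁻¹ * a.2 :=
  Quotient.eq (r := flatSetoid A ρ)

lemma proj_mk (a : A × G) : proj hp ρ (mk hp ρ a) = p a.1 := rfl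

lemma act_mk (a : G) (b : A × G) : act hp ρ a (mk hp ρ b) = mk hp ρ (b.1, b.2 * a) := rfl

lemma mk_out (z : FlatBundle hp ρ) : mk hp ρ (out hp ρ z) = z :=
  Quotient.out_eq (s := flatSetoid A ρ) z

variable [TopologicalSpace G]

instance : TopologicalSpace (FlatBundle hp ρ) :=
  inferInstanceAs (TopologicalSpace (Quotient (flatSetoid A ρ)))

lemma isLocalHomeomorph_mk [ContinuousMul G] : IsLocalHomeomorph (mk hp ρ) := by
  let _ : MulAction Λᵐᵒᵖ (A × G) :=
    { smul := fun z a => (z • a.1, (ρ z.unop)⁻¹ * a.2)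
      one_smul := fun a => by
        change (((1 : Λᵐᵒᵖ) • a.1, (ρ (1 : Λᵐᵒᵖ).unop)⁻¹ * a.2) : A × G) = a
        simp
      mul_smul := fun z w a => by
        change (((z * w) • a.1, (ρ (z * w).unop)⁻¹ * a.2) : A × G) =
          (z • (w • a.1), (ρ z.unop)⁻¹ * ((ρ w.unop)⁻¹ * a.2))
        simp [mul_smul, mul_assoc] }
  have hsmul : ∀ (z : Λᵐᵒᵖ) (a : A × G), z • a = (z • a.1, (ρ z.unop)⁻¹ * a.2) :=
    fun _ _ => rfl
  have := hp.toContinuousConstSMul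
  have hq : IsQuotientCoveringMap (mk hp ρ) Λᵐᵒᵖ :=
    { toIsQuotientMap := isQuotientMap_quot_mk
      continuous_const_smul := fun z => by
        simp only [hsmul]
        exact ((continuous_const_smul z).comp continuous_fst).prodMk
          (continuous_const.mul continuous_snd)
      apply_eq_iff_mem_orbit := by
        intro a b
        rw [eq_comm, mk_eq_iff]
        constructor
        · rintro ⟨z, hx, hg⟩
          exact ⟨MulOpposite.op z, (Prod.ext hx hg).symm⟩
        · rintro ⟨z, hz⟩
          exact ⟨z.unop, (congrArg Prod.fst hz).symm, (congrArg Prod.snd hz).symm⟩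
      disjoint := by
        rintro ⟨x, g⟩
        obtain ⟨U, hU, hd⟩ := hp.disjoint x
        refine ⟨U ×ˢ Set.univ, prod_mem_nhds hU Filter.univ_mem, ?_⟩
        rintro z ⟨_, ⟨a, ha, rfl⟩, hb⟩
        exact hd z ⟨z • a.1, ⟨a.1, ha.1, rfl⟩, hb.1⟩ }
  exact hq.isCoveringMap.isLocalHomeomorph

lemma surjective_mk : Function.Surjective (mk hp ρ) := Quotient.mk_surjective

/-- The smooth structure on the total space of the flat bundle, pushed forward along the covering
`A × G → (A × G) / Λ`. -/
instance {B E : Type*} [TopologicalSpace B] [TopologicalSpace E] [ChartedSpace B A]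
    [ChartedSpace E G] [ContinuousMul G] : ChartedSpace (ModelProd B E) (FlatBundle hp ρ) :=
  (isLocalHomeomorph_mk hp ρ).chartedSpace (surjective_mk hp ρ)

section Connection

variable (B E : Type*) [NormedAddCommGroup B] [NormedSpace ℝ B] [NormedAddCommGroup E]
  [NormedSpace ℝ E] [ChartedSpace B A] [ChartedSpace B Y] [ChartedSpace E G] [ContinuousMul G]

/-- The flat connection on the flat bundle, as a `𝔤`-valued `1`-form on its total space: the form
to which the pullback to `A × G` of the Maurer--Cartan form of `G` descends. A tangent vector at
`z = [x, g]` is lifted to `A × G` by the inverse of the differential of the local diffeomorphism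
`A × G → (A × G) / Λ`; the result does not depend on the representative, by left invariance. -/
def connectionForm (z : FlatBundle hp ρ) :
    TangentSpace (𝓘(ℝ, B).prod 𝓘(ℝ, E)) z →L[ℝ] GroupLieAlgebra 𝓘(ℝ, E) G :=
  let D : (B × E) →L[ℝ] (B × E) :=
    mfderiv (𝓘(ℝ, B).prod 𝓘(ℝ, E)) (𝓘(ℝ, B).prod 𝓘(ℝ, E)) (mk hp ρ) (out hp ρ z)
  let θ : E →L[ℝ] GroupLieAlgebra 𝓘(ℝ, E) G := maurerCartan E (out hp ρ z).2
  θ ∘L ContinuousLinearMap.snd ℝ B E ∘L D.inverse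

/-- `s` is a `C^∞` section over a neighbourhood of `y` of the subset `R` of the bundle. -/
def IsLocalSection (R : Set (FlatBundle hp ρ)) (y : Y) (s : Y → FlatBundle hp ρ) : Prop :=
  ∃ U : Set Y, IsOpen U ∧ y ∈ U ∧
    ContMDiffOn 𝓘(ℝ, B) (𝓘(ℝ, B).prod 𝓘(ℝ, E)) ∞ s U ∧ ∀ y' ∈ U, s y' ∈ R ∧ proj hp ρ (s y') = y'

/-- `R` is (the total space of) a `C^∞` reduction of structure group of the bundle to the closed
subgroup `K`: it is stable under `K`, its fibres over `Y` are nonempty and `K` acts transitively on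
them, and there is a `C^∞` local section of `R` through every point of `R`. -/
structure IsReduction (K : Subgroup G) (R : Set (FlatBundle hp ρ)) : Prop where
  nonempty : ∀ y : Y, ∃ z ∈ R, proj hp ρ z = y
  act_mem : ∀ z ∈ R, ∀ k ∈ K, act hp ρ k z ∈ R
  transitive : ∀ z ∈ R, ∀ z' ∈ R, proj hp ρ z = proj hp ρ z' → ∃ k ∈ K, z' = act hp ρ k z
  exists_section : ∀ z ∈ R, ∃ s, IsLocalSection hp ρ B E R (proj hp ρ z) s ∧ s (proj hp ρ z) = z

end Connection

/-- The fibre over `y` of a reduction `R`. -/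
def Fiber (R : Set (FlatBundle hp ρ)) (y : Y) : Type _ :=
  {z : FlatBundle hp ρ // z ∈ R ∧ proj hp ρ z = y}

end FlatBundle

end FlatBundle

/-! ### The forms `D^𝔭` and `ω_D` -/

section Types

variable {T W : Type*} [AddCommGroup T] [Module ℝ T] [AddCommGroup W] [Module ℝ W]

/-- The `(1, 0)`-part of a real linear form `η` with respect to the complex structure `J`, with
values in the complexification. -/
def type10 (J : T →ₗ[ℝ] T) (η : T →ₗ[ℝ] W) : T →ₗ[ℝ] ℂ ⊗[ℝ] W :=
  (1 / 2 : ℂ) • (TensorProduct.mk ℝ ℂ W 1 ∘ₗ η - TensorProduct.mk ℝ ℂ W Complex.I ∘ₗ η ∘ₗ J)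

/-- The `(0, 1)`-part of a real linear form `η` with respect to the complex structure `J`, with
values in the complexification. -/
def type01 (J : T →ₗ[ℝ] T) (η : T →ₗ[ℝ] W) : T →ₗ[ℝ] ℂ ⊗[ℝ] W :=
  (1 / 2 : ℂ) • (TensorProduct.mk ℝ ℂ W 1 ∘ₗ η + TensorProduct.mk ℝ ℂ W Complex.I ∘ₗ η ∘ₗ J)

lemma type10_add_type01 (J : T →ₗ[ℝ] T) (η : T →ₗ[ℝ] W) (v : T) :
    type10 J η v + type01 J η v = (1 : ℂ) ⊗ₜ[ℝ] η v := by
  simp only [type10, type01, LinearMap.smul_apply, LinearMap.sub_apply, LinearMap.add_apply,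
    LinearMap.comp_apply, TensorProduct.mk_apply, ← smul_add]
  rw [sub_add_add_cancel, ← two_smul ℂ, smul_smul]
  norm_num

lemma type10_J (J : T →ₗ[ℝ] T) (hJ : ∀ v, J (J v) = -v) (η : T →ₗ[ℝ] W) (v : T) :
    type10 J η (J v) = Complex.I • type10 J η v := by
  simp only [type10, LinearMap.smul_apply, LinearMap.sub_apply,
    LinearMap.comp_apply, TensorProduct.mk_apply, hJ, map_neg]
  rw [smul_comm]
  congr 1
  rw [smul_sub, TensorProduct.smul_tmul', TensorProduct.smul_tmul', smul_eq_mul, smul_eq_mul,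
    mul_one, Complex.I_mul_I]
  simp only [TensorProduct.neg_tmul]
  abel

lemma type01_J (J : T →ₗ[ℝ] T) (hJ : ∀ v, J (J v) = -v) (η : T →ₗ[ℝ] W) (v : T) :
    type01 J η (J v) = -(Complex.I • type01 J η v) := by
  simp only [type01, LinearMap.smul_apply, LinearMap.add_apply,
    LinearMap.comp_apply, TensorProduct.mk_apply, hJ, map_neg]
  rw [smul_comm, ← smul_neg]
  congr 1
  rw [smul_add, TensorProduct.smul_tmul', TensorProduct.smul_tmul', smul_eq_mul, smul_eq_mul,
    mul_one, Complex.I_mul_I]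
  simp only [TensorProduct.neg_tmul]
  abel

end Types

/-- The almost complex structure on the real tangent space of a complex manifold. -/
def tangentJ {V Y : Type*} [NormedAddCommGroup V] [NormedSpace ℂ V] [TopologicalSpace Y]
    [ChartedSpace V Y] (y : Y) : TangentSpace 𝓘(ℝ, V) y →ₗ[ℝ] TangentSpace 𝓘(ℝ, V) y :=
  ((LinearMap.lsmul ℂ V Complex.I).restrictScalars ℝ : V →ₗ[ℝ] V)

/-- A map of complex manifolds is anti-holomorphic if it is differentiable and its real
differential anticommutes with the almost complex structures. -/
def IsAntiholomorphic {V F X M : Type*} [NormedAddCommGroup V] [NormedSpace ℂ V]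
    [NormedAddCommGroup F] [NormedSpace ℂ F] [TopologicalSpace X] [ChartedSpace V X]
    [TopologicalSpace M] [ChartedSpace F M] (f : X → M) : Prop :=
  MDifferentiable 𝓘(ℝ, V) 𝓘(ℝ, F) f ∧ ∀ (x : X) (v : TangentSpace 𝓘(ℝ, V) x),
    mfderiv 𝓘(ℝ, V) 𝓘(ℝ, F) f x (tangentJ x v) = -tangentJ (f x) (mfderiv 𝓘(ℝ, V) 𝓘(ℝ, F) f x v)

section Forms

variable {Λ A Y G : Type*} [Group Λ] [TopologicalSpace A] [MulAction Λᵐᵒᵖ A] [TopologicalSpace Y]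
  [Group G] [TopologicalSpace G] {p : A → Y} (hp : IsQuotientCoveringMap p Λᵐᵒᵖ) (ρ : Λ →* G)
  (B E : Type*) [NormedAddCommGroup B] [NormedSpace ℂ B] [NormedAddCommGroup E] [NormedSpace ℝ E]
  [CompleteSpace E] [ChartedSpace B A] [ChartedSpace B Y] [ChartedSpace E G] [ContinuousMul G]
  [LieGroup 𝓘(ℝ, E) ∞ G] (K : Subgroup G) (R : Set (FlatBundle hp ρ))

/-- Complex `1`-forms on `Y` with values in the bundle `R(𝔭) ⊗ ℂ`, where `R(𝔭) = R ×^K 𝔭`. As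
usual, an element of the fibre of `R ×^K 𝔭` at `y` is recorded as the `K`-equivariant map
`R_y → 𝔭`, `z ↦ w`, for which the element is the class of `(z, w)` for every `z ∈ R_y`. (The type
does not impose the equivariance, which the forms considered below satisfy; two sections are equal
exactly when the corresponding maps on `R` are.) -/
abbrev BundleForm : Type _ :=
  ∀ y : Y, FlatBundle.Fiber hp ρ R y → (TangentSpace 𝓘(ℝ, B) y →ₗ[ℝ] ℂ ⊗[ℝ] cartanP E K)

open Classical in
/-- The `R(𝔭)`-valued `1`-form `D^𝔭` on `Y` to which the restriction to `R` of the `𝔭`-part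
`ψ ∘ D` of the connection form descends. At `y` and `z ∈ R_y` it sends `v ∈ T_y Y` to the value of
`ψ ∘ D` on `ds(v)`, where `s` is a smooth local section of `R` with `s y = z`; this does not depend
on `s`. (For a reduction `R` such a section always exists.) -/
def pForm (y : Y) (z : FlatBundle.Fiber hp ρ R y) :
    TangentSpace 𝓘(ℝ, B) y →ₗ[ℝ] cartanP E K :=
  if h : ∃ s : Y → FlatBundle hp ρ, FlatBundle.IsLocalSection hp ρ B E R y s ∧ s y = z.1 then
    let s := h.choose
    projP E K ∘ₗ (FlatBundle.connectionForm hp ρ B E (s y)).toLinearMap ∘ₗ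
      (mfderiv 𝓘(ℝ, B) (𝓘(ℝ, B).prod 𝓘(ℝ, E)) s y).toLinearMap
  else 0

/-- The form `ω_D = (1/√-1) (D^{1,0} - D^{0,1})`, where `D^{1,0}` and `D^{0,1}` are the components
of `D^𝔭` of types `(1, 0)` and `(0, 1)`. -/
def omegaForm : BundleForm hp ρ B E K R := fun y z =>
  (1 / Complex.I) • (type10 (tangentJ y) (pForm hp ρ B E K R y z) -
    type01 (tangentJ y) (pForm hp ρ B E K R y z))

end Forms

/-! ### The universal bundle on `M_Γ`, the map `H_D` and the pullback -/

section Main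

variable {G : Type*} [Group G] [TopologicalSpace G] [IsTopologicalGroup G] [T2Space G]
  (K Γ : Subgroup G) [CompactSpace K] [DiscreteTopology Γ] [TorsionFree Γ]

/-- The manifold structure on `M_Γ = K\G/Γ`, pushed forward along the covering
`K\G → K\G/Γ`. It is real or complex according to the structure used on `K\G`. -/
instance {F : Type*} [TopologicalSpace F] [ChartedSpace F (RightCosets K)] :
    ChartedSpace F (DoubleCosets K Γ) :=
  (isQuotientCoveringMap_doubleCosets K Γ).isCoveringMap.isLocalHomeomorph.chartedSpace
    (isQuotientCoveringMap_doubleCosets K Γ).surjective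

/-- The charts of `K\G` make it a Hermitian symmetric space: they define a complex manifold, with
the quotient smooth structure (the one for which `G → K\G` is a smooth submersion), on which the
elements of `G` act by holomorphic maps. -/
structure IsInvariantComplexStructure (E F : Type*) [NormedAddCommGroup E] [NormedSpace ℝ E]
    [NormedAddCommGroup F] [NormedSpace ℂ F] {G : Type*} [Group G] [TopologicalSpace G]
    [ChartedSpace E G] (K : Subgroup G) [ChartedSpace F (RightCosets K)] : Prop where
  isManifold : IsManifold 𝓘(ℂ, F) ω (RightCosets K)
  contMDiff_mk : ContMDiff 𝓘(ℝ, E) 𝓘(ℝ, F) ∞ (RightCosets.mk K)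
  surjective_mfderiv_mk : ∀ g : G,
    Function.Surjective (mfderiv 𝓘(ℝ, E) 𝓘(ℝ, F) (RightCosets.mk K) g)
  mdifferentiable_smul : ∀ a : Gᵐᵒᵖ,
    MDifferentiable 𝓘(ℂ, F) 𝓘(ℂ, F) (fun m : RightCosets K => a • m)

/-- The universal flat bundle `𝓔_G` on `M_Γ`, the quotient of `(K\G) × G` by the relation
`(m, g) ∼ (m γ⁻¹, γ g)`. -/
abbrev UniversalBundle : Type _ :=
  FlatBundle (isQuotientCoveringMap_doubleCosets K Γ) Γ.subtype

/-- The reduction `𝓔_K ⊂ 𝓔_G`, the image of `{(K g⁻¹, g)} ⊂ (K\G) × G`. -/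
def universalReduction : Set (UniversalBundle K Γ) :=
  Set.range fun g : G => FlatBundle.mk (isQuotientCoveringMap_doubleCosets K Γ) Γ.subtype
    (RightCosets.mk K g⁻¹, g)

variable {K Γ}
variable {Λ A Y : Type*} [Group Λ] [TopologicalSpace A] [MulAction Λᵐᵒᵖ A] [TopologicalSpace Y]
  {p : A → Y} (hp : IsQuotientCoveringMap p Λᵐᵒᵖ) (ρ : Λ →* Γ)

variable (Γ) in
/-- The flat `G`-bundle attached to a homomorphism with values in `Γ`. -/
abbrev RepBundle : Type _ := FlatBundle hp (Γ.subtype.comp ρ)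

variable (R : Set (RepBundle Γ hp ρ))

variable (K) in
/-- The map `h : A → G/K` attached to a reduction `R ⊂ (A × G) / Λ` to `K`: the coset `h x`
consists of the `g` with `[x, g] ∈ R`. -/
def equivariantMap (x : A) : G ⧸ K :=
  QuotientGroup.mk (Classical.epsilon fun g : G => FlatBundle.mk hp (Γ.subtype.comp ρ) (x, g) ∈ R)

variable (K) in
/-- The map `H_D : Y → M_Γ = K\G/Γ` attached to a reduction `R`: the map to which the composition
`A → G/K → K\G → K\G/Γ` of `h` with `ι` descends. -/
def classifyingMap (y : Y) : DoubleCosets K Γ :=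
  DoubleCosets.mk K Γ (cosetInv K (equivariantMap K hp ρ R (Function.surjInv hp.surjective y)))

/-- The map `E_K → 𝓔_K`, `[x, g] ↦ [K g⁻¹, g]`. (The formula makes sense on all of `E_G`, but the
map is only of interest on reductions.) -/
def toUniversal : RepBundle Γ hp ρ → UniversalBundle K Γ :=
  Quotient.map (fun b => (RightCosets.mk K b.2⁻¹, b.2)) (by
    rintro ⟨x, g⟩ ⟨x', g'⟩ ⟨z, -, hg⟩
    simp only at hg
    refine ⟨ρ z, ?_, ?_⟩
    · simp [hg, RightCosets.smul_mk']
    · simp [hg])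

lemma toUniversal_mk (b : A × G) :
    toUniversal (K := K) hp ρ (FlatBundle.mk hp _ b) =
      FlatBundle.mk (isQuotientCoveringMap_doubleCosets K Γ) Γ.subtype
        (RightCosets.mk K b.2⁻¹, b.2) := rfl

lemma toUniversal_mem (z : RepBundle Γ hp ρ) :
    toUniversal hp ρ z ∈ universalReduction K Γ := by
  obtain ⟨b, rfl⟩ := FlatBundle.surjective_mk hp _ z
  exact ⟨b.2, rfl⟩

lemma proj_toUniversal_mk (b : A × G) :
    FlatBundle.proj _ _ (toUniversal (K := K) hp ρ (FlatBundle.mk hp _ b)) =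
      DoubleCosets.mk K Γ (RightCosets.mk K b.2⁻¹) := rfl

variable {R} {E B : Type*} [NormedAddCommGroup B] [NormedSpace ℝ B] [NormedAddCommGroup E]
  [NormedSpace ℝ E] [ChartedSpace B A] [ChartedSpace B Y] [ChartedSpace E G]

lemma equivariantMap_eq (hR : FlatBundle.IsReduction hp (Γ.subtype.comp ρ) B E K R)
    {x : A} {g : G} (hg : FlatBundle.mk hp (Γ.subtype.comp ρ) (x, g) ∈ R) :
    equivariantMap K hp ρ R x = QuotientGroup.mk g := by
  have h := Classical.epsilon_spec
    (p := fun g : G => FlatBundle.mk hp (Γ.subtype.comp ρ) (x, g) ∈ R) ⟨g, hg⟩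
  obtain ⟨k, hk, hgk⟩ := hR.transitive _ h _ hg rfl
  rw [FlatBundle.act_mk, FlatBundle.mk_eq_iff] at hgk
  obtain ⟨z, hz, hzg⟩ := hgk
  have hz1 : MulOpposite.op z = 1 :=
    hp.isCancelSMul.right_cancel _ _ x (by rw [one_smul]; exact hz.symm)
  obtain rfl : z = 1 := MulOpposite.op_injective hz1
  refine QuotientGroup.eq.2 ?_
  simp only [map_one, inv_one, one_mul] at hzg
  exact (eq_inv_mul_of_mul_eq hzg) ▸ hk

lemma classifyingMap_proj (hR : FlatBundle.IsReduction hp (Γ.subtype.comp ρ) B E K R)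
    {z : RepBundle Γ hp ρ} (hz : z ∈ R) :
    classifyingMap K hp ρ R (FlatBundle.proj hp _ z) =
      FlatBundle.proj _ _ (toUniversal (K := K) hp ρ z) := by
  obtain ⟨⟨x, g⟩, rfl⟩ := FlatBundle.surjective_mk hp _ z
  obtain ⟨a, ha⟩ := hp.apply_eq_iff_mem_orbit.1 (Function.surjInv_eq hp.surjective (p x))
  have hmk : FlatBundle.mk hp (Γ.subtype.comp ρ) (x, g) =
      FlatBundle.mk hp _ (a • x, (Γ.subtype.comp ρ a.unop)⁻¹ * g) :=
    (FlatBundle.mk_eq_iff hp _ _ _).2 ⟨a.unop, rfl, rfl⟩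
  have hax : Function.surjInv hp.surjective (p x) = a • x := ha.symm
  rw [classifyingMap, FlatBundle.proj_mk, hax,
    equivariantMap_eq hp ρ hR (hmk ▸ hz), hmk, proj_toUniversal_mk, cosetInv_mk]

/-- The bundle map `E_K → 𝓔_K` over `H_D`, on fibres. -/
def fiberMap (hR : FlatBundle.IsReduction hp (Γ.subtype.comp ρ) B E K R)
    (y : Y) (z : FlatBundle.Fiber hp (Γ.subtype.comp ρ) R y) :
    FlatBundle.Fiber (isQuotientCoveringMap_doubleCosets K Γ) Γ.subtype (universalReduction K Γ)
      (classifyingMap K hp ρ R y) :=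
  ⟨toUniversal hp ρ z.1, toUniversal_mem hp ρ z.1, by
    rw [← classifyingMap_proj hp ρ hR z.2.1, z.2.2]⟩

end Main

section Pullback

variable {G : Type*} [Group G] [TopologicalSpace G] [IsTopologicalGroup G] [T2Space G]
  {K Γ : Subgroup G} [CompactSpace K] [DiscreteTopology Γ] [TorsionFree Γ]
  {Λ A Y : Type*} [Group Λ] [TopologicalSpace A] [MulAction Λᵐᵒᵖ A] [TopologicalSpace Y]
  {p : A → Y} (hp : IsQuotientCoveringMap p Λᵐᵒᵖ) (ρ : Λ →* Γ) {R : Set (RepBundle Γ hp ρ)}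
  {E B F : Type*} [NormedAddCommGroup B] [NormedSpace ℂ B] [NormedAddCommGroup E]
  [NormedSpace ℝ E] [CompleteSpace E] [NormedAddCommGroup F] [NormedSpace ℂ F]
  [ChartedSpace B A] [ChartedSpace B Y] [ChartedSpace E G] [LieGroup 𝓘(ℝ, E) ∞ G]
  [ChartedSpace F (RightCosets K)]

variable (K Γ E F) in
/-- The form `ω_{𝓓⁰}` on `M_Γ` attached to the universal flat bundle and its reduction `𝓔_K`. -/
def universalOmega :
    BundleForm (isQuotientCoveringMap_doubleCosets K Γ) Γ.subtype F E K (universalReduction K Γ) :=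
  omegaForm (isQuotientCoveringMap_doubleCosets K Γ) Γ.subtype F E K (universalReduction K Γ)

/-- The pullback by `H_D` of an `𝓔_K(𝔭)`-valued form on `M_Γ`, as an `E_K(𝔭)`-valued form: it is
composed with the differential of `H_D`, and the fibres of `H_D^* 𝓔_K(𝔭)` are identified with those
of `E_K(𝔭)` through the isomorphism `E_K ≅ H_D^* 𝓔_K`. -/
def pullbackForm (hR : FlatBundle.IsReduction hp (Γ.subtype.comp ρ) B E K R)
    (η : BundleForm (isQuotientCoveringMap_doubleCosets K Γ) Γ.subtype F E K
      (universalReduction K Γ)) :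
    BundleForm hp (Γ.subtype.comp ρ) B E K R := fun y z =>
  η (classifyingMap K hp ρ R y) (fiberMap hp ρ hR y z) ∘ₗ
    (mfderiv 𝓘(ℝ, B) 𝓘(ℝ, F) (classifyingMap K hp ρ R) y).toLinearMap

end Pullback

/-- `β : X' → X` is the universal cover of `X` associated to the base point `x₀`, with base point
`x₀'`, and `π₁(X, x₀)` acts on the right of `X'` by deck transformations in the usual way: `x₀' · z`
is the endpoint of the lift of the loop `z` that starts at `x₀'`. -/
structure IsUniversalCover (V : Type*) {X X' : Type*} [NormedAddCommGroup V] [NormedSpace ℝ V]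
    [TopologicalSpace X] [ChartedSpace V X] [TopologicalSpace X'] [ChartedSpace V X'] (x₀ : X)
    [MulAction (FundamentalGroup X x₀)ᵐᵒᵖ X'] (β : X' → X) (x₀' : X') : Prop where
  simplyConnected : SimplyConnectedSpace X'
  isManifold : IsManifold 𝓘(ℝ, V) ∞ X'
  isLocalDiffeomorph : IsLocalDiffeomorph 𝓘(ℝ, V) 𝓘(ℝ, V) ∞ β
  covering : IsQuotientCoveringMap β (FundamentalGroup X x₀)ᵐᵒᵖ
  base : β x₀' = x₀
  deck : ∀ z : FundamentalGroup X x₀,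
    MulOpposite.op z • x₀' = (covering.isCoveringMap.monodromy z ⟨x₀', base⟩ : X')

end FlatReduction

open FlatReduction

namespace FlatReduction

/-! ### Local diffeomorphisms, submersions and complex structures -/

section Manifolds

/-! For a real form `η` one has `(1/√-1)(η^{1,0} - η^{0,1}) = -η ∘ J`, so both forms `ω` are `-D^𝔭 ∘
J` (`omegaForm_apply`). Write `H` for `H_D` and `θ` for the form `D^𝔭` of the universal bundle.
Suppose that `θ ∘ dH = D^𝔭` and that `θ` is injective on tangent spaces. Then the equality of the
pullback with `±ω_D` at `v` reads `θ(J dH v) = ±D^𝔭(J v) = ±θ(dH(J v))`, which says `J dH v = ±dH(J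
v)`. Since `H` is smooth, this for all `v` is holomorphy, respectively anti-holomorphy.

Both facts come from a local formula. If a section of the reduction lifts to `(x, a)` with values in
`A × G`, then `D^𝔭 = ψ(a⁻¹ da)` (`pForm_apply`); a `K`-valued right factor equal to `1` at the point
changes `a⁻¹ da` there only by elements of `𝔨` (`logDeriv_sub_mem`). In these terms `H = K a⁻¹ Γ`.
On `M_Γ`, a lift `b` to `G` with `K b(M)⁻¹ Γ = M` computes `θ`. The maps `b ∘ H` and `a` differ by a
`K`-valued right factor, whence `θ ∘ dH = D^𝔭` (`pForm_classifyingMap`). If `θ(u) = 0`, then `b⁻¹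
db(u)` lies in `𝔨`, a direction in which the point `K b⁻¹ Γ` does not move, so `u = 0`
(`pForm_universal_injective`).

The projection `ψ` requires `𝔤 = 𝔭 ⊕ 𝔨` (`isCompl_cartanP`). Averaging over the compact group `K`
gives an invariant inner product, for which `ad x` is skew when `x ∈ 𝔨`. Then `tr (ad x)² = 0`
forces `ad x = 0`, and `x = 0` because a simple Lie algebra has trivial center. This rests on the
identity `d Ad = ad` for the bracket of left invariant fields, obtained in the chart at `1`
(`hasFDerivAt_conjugation`, `lie_eq_of_hasFDerivAt`). The smooth structures enter through two facts:
a covering with smooth deck maps is a local diffeomorphism for the pushed-forward charts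
(`isLocalDiffeomorph_chartedSpace`), and the submersion `G → K\G` has smooth local sections. -/

/-- Two local lifts through a local homeomorphism which agree at a point agree near that point. -/
lemma eventuallyEq_of_comp_eventuallyEq {T M N : Type*} [TopologicalSpace T] [TopologicalSpace M]
    [TopologicalSpace N] {q : M → N} (hq : IsLocalHomeomorph q) {f₁ f₂ : T → M} {t : T}
    (h₁ : ContinuousAt f₁ t) (h₂ : ContinuousAt f₂ t) (h : f₁ t = f₂ t)
    (hcomp : ∀ᶠ s in 𝓝 t, q (f₁ s) = q (f₂ s)) : f₁ =ᶠ[𝓝 t] f₂ := by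
  have hL := (hq.localInverseAt (f₁ t)).open_target.mem_nhds hq.self_mem_localInverseAt_target
  have hL₂ : (hq.localInverseAt (f₁ t)).target ∈ 𝓝 (f₂ t) := by rwa [← h]
  filter_upwards [hcomp, h₁ hL, h₂ hL₂] with s hs hs₁ hs₂
  -- The map `q` is injective on the target of its local inverse, where both lifts eventually lie.
  have hinj := (hq.localInverseAt (f₁ t)).symm.injOn
  rw [OpenPartialHomeomorph.symm_source, hq.localInverseAt_symm] at hinj
  exact hinj hs₁ hs₂ hs

/-- If the fibres of a surjective local homeomorphism `q` are permuted by smooth maps, then `q` is a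
local diffeomorphism for the smooth structure pushed forward along `q`. -/
theorem isLocalDiffeomorph_chartedSpace {𝕜 E H M N : Type*} [NontriviallyNormedField 𝕜]
    [NormedAddCommGroup E] [NormedSpace 𝕜 E] [TopologicalSpace H] {I : ModelWithCorners 𝕜 E H}
    {n : WithTop ℕ∞} [TopologicalSpace M] [ChartedSpace H M] [TopologicalSpace N] {q : M → N}
    (hq : IsLocalHomeomorph q) (hs : Function.Surjective q)
    (hdeck : ∀ a a', q a = q a' → ∃ ψ : M → M, ContMDiff I I n ψ ∧ ψ a = a' ∧ ∀ x, q (ψ x) = q x) :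
    letI := hq.chartedSpace (H := H) hs
    IsLocalDiffeomorph I I n q := by
  let _ := hq.chartedSpace (H := H) hs
  -- The same choice of preimages as in `IsLocalHomeomorph.chartedSpace`: the chart at `y` is the
  -- local inverse at `g y` followed by the chart at `g y`.
  set g := hs.hasRightInverse.choose with hg
  have hgr : Function.RightInverse g q := hs.hasRightInverse.choose_spec
  have hgL : ∀ y, (hq.localInverseAt (g y)) y = g y := by
    intro y
    have h := (hq.localInverseAt (g y)).right_inv hq.self_mem_localInverseAt_target
    rw [hq.localInverseAt_symm, hgr y] at h
    exact h
  have hy : ∀ y, y ∈ (hq.localInverseAt (g y)).source := by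
    intro y
    rw [← congrArg (· ∈ (hq.localInverseAt (g y)).source) (hgr y)]
    exact hq.apply_self_mem_localInverseAt_source
  have hqL : ∀ a, ∀ y ∈ (hq.localInverseAt a).source, q (hq.localInverseAt a y) = y := by
    intro a y h
    have := (hq.localInverseAt a).left_inv h
    rwa [hq.localInverseAt_symm] at this
  have hchart : ∀ y, extChartAt I y =
    (hq.localInverseAt (g y)).toPartialEquiv.trans (extChartAt I (g y)) := by
    intro y
    change (((hq.localInverseAt (g y)).trans (chartAt H (g y))).extend I) = _
    simp [OpenPartialHomeomorph.extend, extChartAt, PartialEquiv.trans_assoc]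
  -- the map `q` is smooth
  have hqs : ∀ a, ContMDiffAt I I n q a := by
    intro a
    -- The chart at `q a` is built at `g (q a)`, which need not be `a`. A deck map `ψ` carries `a`
    -- there, and near `a` the local inverse in this chart composed with `q` is `ψ`.
    obtain ⟨ψ, hψ, hψa, hqψ⟩ := hdeck a (g (q a)) (hgr (q a)).symm
    refine contMDiffAt_iff_target.2 ⟨hq.continuous.continuousAt, ?_⟩
    have h1 := (contMDiffAt_iff_target.1 (hψ a)).2
    rw [hψa] at h1
    refine h1.congr_of_eventuallyEq ?_
    have h2 : (fun x => hq.localInverseAt (g (q a)) (q x)) =ᶠ[𝓝 a] ψ := by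
      refine eventuallyEq_of_comp_eventuallyEq hq ?_ (hψ a).continuousAt ?_ ?_
      · exact ((hq.localInverseAt (g (q a))).continuousAt (hy _)).comp hq.continuous.continuousAt
      · rw [hψa, hgL]
      · filter_upwards [hq.continuous.continuousAt
          ((hq.localInverseAt (g (q a))).open_source.mem_nhds (hy _))] with x hx
        rw [hqψ, hqL _ _ hx]
    filter_upwards [h2] with x hx
    simp only [Function.comp_apply, hchart, PartialEquiv.coe_trans] at hx ⊢
    exact congrArg _ hx
  -- the chosen local inverses are smooth
  have hL : ∀ y, ContMDiffAt I I n (hq.localInverseAt (g y)) y := by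
    intro y
    refine contMDiffAt_iff.2 ⟨(hq.localInverseAt (g y)).continuousAt (hy _), ?_⟩
    rw [hgL]
    -- By the shape of the chart at `y`, the local inverse read in charts is the identity.
    refine contDiffWithinAt_id.congr_of_eventuallyEq ?_ ?_
    · rw [hchart]
      simp only [PartialEquiv.coe_trans, Function.comp_apply]
      have hgy : (hq.localInverseAt (g y)).toPartialEquiv y = g y := hgL y
      rw [hgy]
      have h1 := extChartAt_target_mem_nhdsWithin (I := I) (g y)
      have h2 := (continuousAt_extChartAt_symm (I := I) (g y)).continuousWithinAt (s := Set.range I)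
        ((hq.localInverseAt (g y)).open_target.mem_nhds
        (by simp))
      filter_upwards [h1, h2] with z hz hz2
      have h3 := (hq.localInverseAt (g y)).right_inv hz2
      have h4 := (extChartAt I (g y)).right_inv hz
      simp only [PartialEquiv.coe_trans_symm, Function.comp_apply, id]
      exact (congrArg (extChartAt I (g y)) h3).trans h4
    · rw [Function.comp_apply, Function.comp_apply, extChartAt_to_inv, hchart]
      rfl
  intro a
  have hsec : ∀ y ∈ (hq.localInverseAt a).source, ContMDiffAt I I n (hq.localInverseAt a) y := by
    intro y hya
    -- For an arbitrary preimage `a`, the local inverse is near `y` the chosen one followed by a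
    -- deck map.
    obtain ⟨ψ, hψ, hψa, hqψ⟩ := hdeck (g y) (hq.localInverseAt a y) (by rw [hgr y, hqL a y hya])
    have h1 : ContMDiffAt I I n (ψ ∘ hq.localInverseAt (g y)) y := hψ.contMDiffAt.comp y (hL y)
    refine h1.congr_of_eventuallyEq ?_
    refine eventuallyEq_of_comp_eventuallyEq hq ((hq.localInverseAt a).continuousAt hya)
      h1.continuousAt ?_ ?_
    · rw [Function.comp_apply, hgL, hψa]
    · filter_upwards [(hq.localInverseAt a).open_source.mem_nhds hya,
        (hq.localInverseAt (g y)).open_source.mem_nhds (hy y)] with z hz1 hz2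
      rw [Function.comp_apply, hqψ, hqL _ _ hz1, hqL _ _ hz2]
  refine ⟨{ toPartialEquiv := (hq.localInverseAt a).symm.toPartialEquiv
            open_source := (hq.localInverseAt a).open_target
            open_target := (hq.localInverseAt a).open_source
            contMDiffOn_toFun := ?_
            contMDiffOn_invFun := ?_ }, hq.self_mem_localInverseAt_target, ?_⟩
  · intro x _
    have : ContMDiffAt I I n (hq.localInverseAt a).symm x := by
      rw [hq.localInverseAt_symm]; exact hqs x
    exact this.contMDiffWithinAt
  · intro y hya
    exact (hsec y hya).contMDiffWithinAt
  · intro x _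
    exact (congrFun (hq.localInverseAt_symm a) x).symm

/-! ### Submersions, and real versus complex differentiability -/

variable {V F : Type*} [NormedAddCommGroup V] [NormedAddCommGroup F]

/-- The differential is by definition a derivative within the range of the model, which is the whole
space here. The map `D` is typed between the model spaces so that later arguments avoid tangent
space types. -/
theorem hasFDerivAt_writtenInExtChartAt [NormedSpace ℝ V] [NormedSpace ℝ F] {X M : Type*}
    [TopologicalSpace X] [ChartedSpace V X] [TopologicalSpace M] [ChartedSpace F M] {f : X → M}
    {x : X} (h : MDifferentiableAt 𝓘(ℝ, V) 𝓘(ℝ, F) f x) {D : V →L[ℝ] F}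
    (hD : D = mfderiv 𝓘(ℝ, V) 𝓘(ℝ, F) f x) :
    HasFDerivAt (extChartAt 𝓘(ℝ, F) (f x) ∘ f ∘ (extChartAt 𝓘(ℝ, V) x).symm) D
      (extChartAt 𝓘(ℝ, V) x x) :=
  hD ▸ HasFDerivWithinAt.hasFDerivAt h.hasMFDerivAt.2 (by simp)

/-- A submersion between finite-dimensional manifolds has smooth local sections. -/
theorem exists_contMDiffOn_section [NormedSpace ℝ V] [NormedSpace ℝ F]
    [FiniteDimensional ℝ V] [FiniteDimensional ℝ F]
    {M N : Type*} [TopologicalSpace M] [ChartedSpace V M] [IsManifold 𝓘(ℝ, V) ∞ M]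
    [TopologicalSpace N] [ChartedSpace F N] [IsManifold 𝓘(ℝ, F) ∞ N] {f : M → N}
    (hf : ContMDiff 𝓘(ℝ, V) 𝓘(ℝ, F) ∞ f) (x : M)
    (hx : Function.Surjective (mfderiv 𝓘(ℝ, V) 𝓘(ℝ, F) f x)) :
    ∃ (τ : N → M) (U : Set N), IsOpen U ∧ f x ∈ U ∧ ContMDiffOn 𝓘(ℝ, F) 𝓘(ℝ, V) ∞ τ U ∧
      τ (f x) = x ∧ ∀ y ∈ U, f (τ y) = y := by
  have : CompleteSpace F := FiniteDimensional.complete ℝ F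
  set e := extChartAt 𝓘(ℝ, V) x with he
  set e' := extChartAt 𝓘(ℝ, F) (f x) with he'
  set f₀ : V → F := e' ∘ f ∘ e.symm with hf₀
  set Ω : Set V := e.target ∩ e.symm ⁻¹' (f ⁻¹' e'.source) with hΩ
  have hΩo : IsOpen Ω :=
    (continuousOn_extChartAt_symm x).isOpen_inter_preimage (isOpen_extChartAt_target x)
      ((isOpen_extChartAt_source (f x)).preimage hf.continuous)
  have hf₀s : ∀ z ∈ Ω, ContDiffAt ℝ ∞ f₀ z := by
    intro z hz
    refine contMDiffAt_iff_contDiffAt.1 ?_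
    have h1 : ContMDiffAt 𝓘(ℝ, V) 𝓘(ℝ, V) ∞ e.symm z :=
      (contMDiffOn_extChartAt_symm x).contMDiffAt ((isOpen_extChartAt_target x).mem_nhds hz.1)
    have h2 : ContMDiffAt 𝓘(ℝ, F) 𝓘(ℝ, F) ∞ e' (f (e.symm z)) :=
      contMDiffAt_extChartAt' (by simpa [he'] using hz.2)
    exact h2.comp z (hf.contMDiffAt.comp z h1)
  have hexΩ : e x ∈ Ω := by
    refine ⟨mem_extChartAt_target x, ?_⟩
    simp [he, he']
  obtain ⟨D, hD⟩ : ∃ D : V →L[ℝ] F, D = mfderiv 𝓘(ℝ, V) 𝓘(ℝ, F) f x := ⟨_, rfl⟩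
  have hDs : Function.Surjective D := hD ▸ hx
  have hfd : HasFDerivAt f₀ D (e x) :=
    hasFDerivAt_writtenInExtChartAt (hf.mdifferentiableAt (by simp)) hD
  -- A linear right inverse `L` of the differential gives an affine slice `j` transverse to the
  -- fibre. Restricted to it, the map has derivative `D ∘ L = 1`, and the inverse function theorem
  -- applies.
  obtain ⟨L, hL⟩ := D.toLinearMap.exists_rightInverse_of_surjective (LinearMap.range_eq_top.2 hDs)
  set j : F → V := fun y => e x + LinearMap.toContinuousLinearMap L (y - e' (f x)) with hj
  have hjs : ContDiff ℝ ∞ j :=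
    contDiff_const.add ((LinearMap.toContinuousLinearMap L).contDiff.comp
      (contDiff_id.sub contDiff_const))
  have hj0 : j (e' (f x)) = e x := by simp [hj]
  set h : F → F := f₀ ∘ j with hh
  have hhs : ∀ y ∈ j ⁻¹' Ω, ContDiffAt ℝ ∞ h y := fun y hy =>
    (hf₀s _ hy).comp y hjs.contDiffAt
  have hy0 : e' (f x) ∈ j ⁻¹' Ω := by rw [Set.mem_preimage, hj0]; exact hexΩ
  have hh0 : h (e' (f x)) = e' (f x) := by
    simp only [hh, Function.comp_apply, hj0, hf₀]
    rw [he, extChartAt_to_inv]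
  have hhd : HasFDerivAt h ((ContinuousLinearEquiv.refl ℝ F : F ≃L[ℝ] F) : F →L[ℝ] F)
      (e' (f x)) := by
    have h1 : HasFDerivAt j (LinearMap.toContinuousLinearMap L) (e' (f x)) :=
      ((LinearMap.toContinuousLinearMap L).hasFDerivAt.comp _
        ((hasFDerivAt_id _).sub_const _)).const_add _
    have h2 : HasFDerivAt f₀ D (j (e' (f x))) := by rw [hj0]; exact hfd
    have h3 := h2.comp _ h1
    refine h3.congr_fderiv ?_
    ext v
    exact LinearMap.congr_fun hL v
  set Φ := (hhs _ hy0).toOpenPartialHomeomorph h hhd (by simp) with hΦ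
  have hΦc : (Φ : F → F) = h := rfl
  have hy0s : e' (f x) ∈ Φ.source :=
    (hhs _ hy0).mem_toOpenPartialHomeomorph_source hhd (by simp)
  -- Smoothness of `Φ.symm` is needed on a whole neighbourhood. The derivative of `h` stays
  -- invertible near the point because invertible maps form an open set.
  have hnear : {y | ∃ E : F ≃L[ℝ] F, (E : F →L[ℝ] F) = fderiv ℝ h y} ∈ 𝓝 (e' (f x)) := by
    have h1 : ContinuousAt (fderiv ℝ h) (e' (f x)) :=
      ((hhs _ hy0).fderiv_right (m := 0) (by simp)).continuousAt
    have h2 := (ContinuousLinearEquiv.refl ℝ F).nhds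
    rw [← hhd.fderiv] at h2
    exact h1 h2
  obtain ⟨W, hW, hWo, hyW⟩ := mem_nhds_iff.1 (Filter.inter_mem hnear
    ((hΩo.preimage hjs.continuous).mem_nhds hy0))
  have hsymm0 : Φ.symm (e' (f x)) = e' (f x) := by
    have := Φ.left_inv hy0s
    rwa [hΦc, hh0] at this
  set U : Set N := e'.source ∩ e' ⁻¹' (Φ.target ∩ Φ.symm ⁻¹' W) with hU
  have hsm : ∀ y ∈ Φ.target ∩ Φ.symm ⁻¹' W, ContDiffAt ℝ ∞ Φ.symm y := by
    rintro y ⟨hy, hyW⟩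
    obtain ⟨⟨E, hE⟩, hyΩ⟩ := hW hyW
    refine Φ.contDiffAt_symm (f₀' := E) hy ?_ (hhs _ hyΩ)
    rw [hE]
    exact ((hhs _ hyΩ).differentiableAt (by simp)).hasFDerivAt
  refine ⟨fun y => e.symm (j (Φ.symm (e' y))), U, ?_, ?_, ?_, ?_, ?_⟩
  · exact (continuousOn_extChartAt (f x)).isOpen_inter_preimage (isOpen_extChartAt_source _)
      (Φ.isOpen_inter_preimage_symm hWo)
  · refine ⟨mem_extChartAt_source (f x), ?_, ?_⟩
    · have := Φ.map_source hy0s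
      rwa [hΦc, hh0] at this
    · rw [Set.mem_preimage, hsymm0]; exact hyW
  · intro y hy
    have h1 : ContMDiffAt 𝓘(ℝ, F) 𝓘(ℝ, F) ∞ e' y :=
      contMDiffAt_extChartAt' (by simpa [he'] using hy.1)
    have h2 : ContMDiffAt 𝓘(ℝ, F) 𝓘(ℝ, V) ∞ (j ∘ Φ.symm) (e' y) :=
      (hjs.contDiffAt.comp _ (hsm _ hy.2)).contMDiffAt
    have h3 : ContMDiffAt 𝓘(ℝ, V) 𝓘(ℝ, V) ∞ e.symm (j (Φ.symm (e' y))) :=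
      (contMDiffOn_extChartAt_symm x).contMDiffAt
        ((isOpen_extChartAt_target x).mem_nhds (hW hy.2.2).2.1)
    exact (h3.comp y (h2.comp y h1)).contMDiffWithinAt
  · simp only [hsymm0, hj0]
    exact extChartAt_to_inv x
  · intro y hy
    have h1 : f (e.symm (j (Φ.symm (e' y)))) ∈ e'.source := (hW hy.2.2).2.2
    refine e'.injOn h1 hy.1 ?_
    exact Φ.right_inv hy.2.1

/-- A complex manifold is a real manifold. -/
theorem isManifold_real_of_complex [NormedSpace ℂ F] {M : Type*}
    [TopologicalSpace M] [ChartedSpace F M] (h : IsManifold 𝓘(ℂ, F) ω M) :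
    IsManifold 𝓘(ℝ, F) ∞ M := by
  refine isManifold_of_contDiffOn 𝓘(ℝ, F) ∞ M ?_
  intro e e' he he'
  have h1 := (contDiffGroupoid ω 𝓘(ℂ, F)).compatible (H := F) (M := M) he he'
  rw [contDiffGroupoid, mem_groupoid_of_pregroupoid] at h1
  have h2 : ContDiffOn ℂ ω (𝓘(ℂ, F) ∘ (e.symm ≫ₕ e') ∘ 𝓘(ℂ, F).symm)
    (𝓘(ℂ, F).symm ⁻¹' (e.symm ≫ₕ e').source ∩ Set.range 𝓘(ℂ, F)) := h1.1
  -- Complex analytic transition maps are real analytic, hence smooth.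
  exact (h2.restrict_scalars ℝ).of_le (by simp)

/-- A real linear map commuting with multiplication by `i` is complex linear, since `ℂ = ℝ + iℝ`. -/
theorem differentiableAt_complex_iff [NormedSpace ℂ V] [NormedSpace ℂ F] {f : V → F} {x : V} :
    DifferentiableAt ℂ f x ↔ DifferentiableAt ℝ f x ∧
      ∀ v, fderiv ℝ f x (Complex.I • v) = Complex.I • fderiv ℝ f x v := by
  constructor
  · intro h
    refine ⟨h.restrictScalars ℝ, fun v => ?_⟩
    rw [h.fderiv_restrictScalars ℝ]
    simp
  · rintro ⟨h, hI⟩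
    refine (differentiableAt_iff_restrictScalars ℝ h).2 ⟨⟨⟨⟨fderiv ℝ f x, map_add _⟩, ?_⟩, ?_⟩, rfl⟩
    · intro c v
      simp only [RingHom.id_apply]
      conv_lhs => rw [← Complex.re_add_im c, add_smul, mul_smul, map_add]
      conv_rhs => rw [← Complex.re_add_im c, add_smul, mul_smul]
      rw [Complex.coe_smul, Complex.coe_smul, Complex.coe_smul, Complex.coe_smul, map_smul,
        map_smul, hI]
    · exact (fderiv ℝ f x).cont

/-- A map of complex manifolds is holomorphic at a point if and only if it is real differentiable
there and its differential commutes with the almost complex structures. -/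
theorem mdifferentiableAt_complex_iff [NormedSpace ℂ V] [NormedSpace ℂ F] {X M : Type*}
    [TopologicalSpace X] [ChartedSpace V X] [TopologicalSpace M] [ChartedSpace F M] {f : X → M}
    {x : X} : MDifferentiableAt 𝓘(ℂ, V) 𝓘(ℂ, F) f x ↔ MDifferentiableAt 𝓘(ℝ, V) 𝓘(ℝ, F) f x ∧
      ∀ v : TangentSpace 𝓘(ℝ, V) x, mfderiv 𝓘(ℝ, V) 𝓘(ℝ, F) f x (tangentJ x v) =
        tangentJ (f x) (mfderiv 𝓘(ℝ, V) 𝓘(ℝ, F) f x v) := by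
  rw [mdifferentiableAt_iff, mdifferentiableAt_iff]
  simp only [modelWithCornersSelf_coe, Set.range_id, differentiableWithinAt_univ]
  rw [differentiableAt_complex_iff, and_assoc]
  refine and_congr_right fun hc => and_congr_right fun hd => ?_
  have hm : MDifferentiableAt 𝓘(ℝ, V) 𝓘(ℝ, F) f x := by
    rw [mdifferentiableAt_iff]
    simp only [modelWithCornersSelf_coe, Set.range_id, differentiableWithinAt_univ]
    exact ⟨hc, hd⟩
  obtain ⟨D, hD⟩ : ∃ D : V →L[ℝ] F, D = mfderiv 𝓘(ℝ, V) 𝓘(ℝ, F) f x := ⟨_, rfl⟩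
  -- The extended charts over `ℂ` and over `ℝ` are the same maps, so `D` is also the real derivative
  -- in the complex charts.
  have h1 : fderiv ℝ (writtenInExtChartAt 𝓘(ℂ, V) 𝓘(ℂ, F) x f) (extChartAt 𝓘(ℂ, V) x x) = D :=
    (hasFDerivAt_writtenInExtChartAt hm hD).fderiv
  rw [h1, ← hD]
  rfl

end Manifolds

/-! ### The differential of the adjoint representation -/

section Adjoint

/-- Infinitesimal comparison of multiplication and conjugation: if `M` is a local multiplication
with unit `x₀` and `C` the corresponding conjugation, then the derivative of the linear part of
`C (x, ·)` at `x₀` is the commutator of the mixed second derivative of `M`. -/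
theorem hasFDerivAt_conjugation {E : Type*} [NormedAddCommGroup E] [NormedSpace ℝ E]
    {M C : E × E → E} {x₀ : E} (hM : ContDiffAt ℝ ∞ M (x₀, x₀)) (hC : ContDiffAt ℝ ∞ C (x₀, x₀))
    (hMC : ∀ᶠ p in 𝓝 (x₀, x₀), M (C p, p.1) = M p) (hM₁ : ∀ᶠ x in 𝓝 x₀, M (x, x₀) = x)
    (hM₂ : ∀ᶠ x in 𝓝 x₀, M (x₀, x) = x)
    (hC₀ : ∀ᶠ x in 𝓝 x₀, C (x, x₀) = x₀) :
    ∃ A' Q' : E →L[ℝ] E →L[ℝ] E,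
      HasFDerivAt (fun x => fderiv ℝ C (x, x₀) ∘L ContinuousLinearMap.inr ℝ E E) A' x₀ ∧
      HasFDerivAt (fun x => fderiv ℝ M (x, x₀) ∘L ContinuousLinearMap.inr ℝ E E) Q' x₀ ∧
      ∀ v w, A' v w = Q' v w - Q' w v := by
  set D := fderiv ℝ (fderiv ℝ M) (x₀, x₀) with hD
  have hsymm : ∀ a b, D a b = D b a := fun a b =>
    (hM.isSymmSndFDerivAt (by
      rw [minSmoothness_of_isRCLikeNormedField]; exact ENat.LEInfty.out)).eq a b
  have hD' : HasFDerivAt (fderiv ℝ M) D (x₀, x₀) :=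
    -- The rewriting supplies `1 + 1 ≤ ∞`.
    ((hM.fderiv_right (m := 1) (one_add_one_eq_two (R := ℕ∞ω) ▸
      ENat.LEInfty.out)).differentiableAt (by simp)).hasFDerivAt
  have hDC : HasFDerivAt (fderiv ℝ C) (fderiv ℝ (fderiv ℝ C) (x₀, x₀)) (x₀, x₀) :=
    ((hC.fderiv_right (m := 1) (one_add_one_eq_two (R := ℕ∞ω) ▸
      ENat.LEInfty.out)).differentiableAt (by simp)).hasFDerivAt
  have hl : ∀ x, HasFDerivAt (fun x : E => (x, x₀)) (ContinuousLinearMap.inl ℝ E E) x := fun x =>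
    (hasFDerivAt_id x).prodMk (hasFDerivAt_const x₀ x)
  have hr : ∀ z x, HasFDerivAt (fun x : E => (z, x)) (ContinuousLinearMap.inr ℝ E E) x :=
    fun z x => (hasFDerivAt_const z x).prodMk (hasFDerivAt_id x)
  set Rr := (ContinuousLinearMap.compL ℝ E (E × E) E).flip (ContinuousLinearMap.inr ℝ E E)
  set Rl := (ContinuousLinearMap.compL ℝ E (E × E) E).flip (ContinuousLinearMap.inl ℝ E E)
  have hQ : HasFDerivAt (fun x => fderiv ℝ M (x, x₀) ∘L ContinuousLinearMap.inr ℝ E E)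
      (Rr ∘L D ∘L ContinuousLinearMap.inl ℝ E E) x₀ :=
    Rr.hasFDerivAt.comp x₀ (hD'.comp (f := fun x => (x, x₀)) x₀ (hl x₀))
  have hA : HasFDerivAt (fun x => fderiv ℝ C (x, x₀) ∘L ContinuousLinearMap.inr ℝ E E)
      (Rr ∘L fderiv ℝ (fderiv ℝ C) (x₀, x₀) ∘L ContinuousLinearMap.inl ℝ E E) x₀ :=
    Rr.hasFDerivAt.comp x₀ (hDC.comp (f := fun x => (x, x₀)) x₀ (hl x₀))
  have hP : HasFDerivAt (fun x => fderiv ℝ M (x₀, x) ∘L ContinuousLinearMap.inl ℝ E E)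
      (Rl ∘L D ∘L ContinuousLinearMap.inr ℝ E E) x₀ :=
    Rl.hasFDerivAt.comp x₀ (hD'.comp x₀ (hr x₀ x₀))
  refine ⟨_, _, hA, hQ, fun v w => ?_⟩
  have hMd : ∀ᶠ p in 𝓝 (x₀, x₀), DifferentiableAt ℝ M p := by
    filter_upwards [(hM.of_le (m := 1) (by simp)).eventually (by simp)] with p hp
    exact hp.differentiableAt (by simp)
  have hCd : ∀ᶠ p in 𝓝 (x₀, x₀), DifferentiableAt ℝ C p := by
    filter_upwards [(hC.of_le (m := 1) (by simp)).eventually (by simp)] with p hp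
    exact hp.differentiableAt (by simp)
  have cl : Filter.Tendsto (fun x : E => (x, x₀)) (𝓝 x₀) (𝓝 (x₀, x₀)) :=
    (hl x₀).continuousAt
  have cr : Filter.Tendsto (fun x : E => (x₀, x)) (𝓝 x₀) (𝓝 (x₀, x₀)) :=
    (hr x₀ x₀).continuousAt
  have hPA : (fun x => (fderiv ℝ M (x₀, x) ∘L ContinuousLinearMap.inl ℝ E E) ∘L
      (fderiv ℝ C (x, x₀) ∘L ContinuousLinearMap.inr ℝ E E)) =ᶠ[𝓝 x₀]
      fun x => fderiv ℝ M (x, x₀) ∘L ContinuousLinearMap.inr ℝ E E := by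
    -- For fixed `x` near `x₀`, the identity `M (C (x, y), x) = M (x, y)` holds for `y` near `x₀`
    -- and can be differentiated in `y` at `x₀`. The inner point is `C (x, x₀) = x₀`.
    rw [nhds_prod_eq] at hMC
    filter_upwards [hMC.curry, cl.eventually hMd, cr.eventually hMd, cl.eventually hCd, hC₀]
      with x hx h1 h2 h3 h4
    have e1 : HasFDerivAt (fun y => M (x, y))
        (fderiv ℝ M (x, x₀) ∘L ContinuousLinearMap.inr ℝ E E) x₀ :=
      h1.hasFDerivAt.comp x₀ (hr x x₀)
    have e2 : HasFDerivAt (fun y => C (x, y))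
        (fderiv ℝ C (x, x₀) ∘L ContinuousLinearMap.inr ℝ E E) x₀ :=
      h3.hasFDerivAt.comp x₀ (hr x x₀)
    have e3 : HasFDerivAt (fun z => M (z, x))
        (fderiv ℝ M (x₀, x) ∘L ContinuousLinearMap.inl ℝ E E) (C (x, x₀)) := by
      rw [h4]
      exact h2.hasFDerivAt.comp x₀ ((hasFDerivAt_id x₀).prodMk (hasFDerivAt_const x x₀))
    exact ((e3.comp x₀ e2).congr_of_eventuallyEq
      (hx.mono fun y hy => hy.symm)).unique e1
  have hPid : fderiv ℝ M (x₀, x₀) ∘L ContinuousLinearMap.inl ℝ E E = ContinuousLinearMap.id ℝ E :=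
    ((hMd.self_of_nhds.hasFDerivAt.comp (f := fun x => (x, x₀)) x₀ (hl x₀)).congr_of_eventuallyEq
      (hM₁.mono fun x hx => hx.symm)).unique (hasFDerivAt_id x₀)
  have hQid : fderiv ℝ M (x₀, x₀) ∘L ContinuousLinearMap.inr ℝ E E =
      fderiv ℝ C (x₀, x₀) ∘L ContinuousLinearMap.inr ℝ E E := by
    have := hPA.self_of_nhds
    simp only [hPid] at this
    rw [← this]
    exact ContinuousLinearMap.id_comp _
  have hA0' : fderiv ℝ C (x₀, x₀) ∘L ContinuousLinearMap.inr ℝ E E = ContinuousLinearMap.id ℝ E :=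
    hQid ▸ ((hMd.self_of_nhds.hasFDerivAt.comp x₀ (hr x₀ x₀)).congr_of_eventuallyEq
      (hM₂.mono fun x hx => hx.symm)).unique (hasFDerivAt_id x₀)
  -- The product rule in `x` at `x₀`. There both factors are the identity, so `A' v w + D (0, v) (w,
  -- 0) = Q' v w`; the symmetry of `D` turns the second term into `Q' w v`.
  have key := ((hP.clm_comp hA).congr_of_eventuallyEq hPA.symm).unique hQ
  have h1 := DFunLike.congr_fun (DFunLike.congr_fun key v) w
  have hP0 : ∀ z, fderiv ℝ M (x₀, x₀) (z, 0) = z := DFunLike.congr_fun hPid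
  have hA0 : ∀ z, fderiv ℝ C (x₀, x₀) (0, z) = z := by
    intro z
    have h2 := DFunLike.congr_fun hA0' z
    exact h2
  have h2 : fderiv ℝ M (x₀, x₀) (fderiv ℝ (fderiv ℝ C) (x₀, x₀) (v, 0) (0, w), 0) +
    D (0, v) (fderiv ℝ C (x₀, x₀) (0, w), 0) = D (v, 0) (0, w) := h1
  rw [hP0, hA0] at h2
  change fderiv ℝ (fderiv ℝ C) (x₀, x₀) (v, 0) (0, w) = D (v, 0) (0, w) - D (w, 0) (0, v)
  rw [hsymm (w, 0), ← h2, add_sub_cancel_right]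

/-! ### Multiplication, conjugation and the bracket in the chart at `1` -/

variable (E : Type*) [NormedAddCommGroup E] [NormedSpace ℝ E]
  (G : Type*) [TopologicalSpace G] [ChartedSpace E G] [Group G]

/-- The multiplication of a Lie group in the preferred chart at `1`. -/
def localMul (p : E × E) : E :=
  extChartAt 𝓘(ℝ, E) (1 : G) ((extChartAt 𝓘(ℝ, E) (1 : G)).symm p.1 *
    (extChartAt 𝓘(ℝ, E) (1 : G)).symm p.2)

/-- The conjugation `(g, h) ↦ g h g⁻¹` of a Lie group in the preferred chart at `1`. -/
def localConj (p : E × E) : E :=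
  extChartAt 𝓘(ℝ, E) (1 : G) ((extChartAt 𝓘(ℝ, E) (1 : G)).symm p.1 *
    (extChartAt 𝓘(ℝ, E) (1 : G)).symm p.2 * ((extChartAt 𝓘(ℝ, E) (1 : G)).symm p.1)⁻¹)

/-- The differential of a map of `G` fixing `1`, in the preferred chart at `1`. -/
lemma hasFDerivAt_of_fix_one {f : G → G} (hf : MDifferentiableAt 𝓘(ℝ, E) 𝓘(ℝ, E) f 1)
    (h1 : f 1 = 1) {D : E →L[ℝ] E} (hD : D = mfderiv 𝓘(ℝ, E) 𝓘(ℝ, E) f 1) :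
    HasFDerivAt (extChartAt 𝓘(ℝ, E) (1 : G) ∘ f ∘ (extChartAt 𝓘(ℝ, E) (1 : G)).symm) D
      (extChartAt 𝓘(ℝ, E) (1 : G) 1) := by
  have := hasFDerivAt_writtenInExtChartAt hf hD
  rwa [h1] at this

lemma localMul_one_left : ∀ᶠ x in 𝓝 (extChartAt 𝓘(ℝ, E) (1 : G) 1),
    localMul E G (extChartAt 𝓘(ℝ, E) (1 : G) 1, x) = x := by
  filter_upwards [extChartAt_target_mem_nhds (I := 𝓘(ℝ, E)) (1 : G)] with x hx
  simp only [localMul, extChartAt_to_inv, one_mul]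
  exact (extChartAt 𝓘(ℝ, E) (1 : G)).right_inv hx

variable [LieGroup 𝓘(ℝ, E) ∞ G]

lemma contMDiffAt_extChartAt_one_symm {x : E} (hx : x ∈ (extChartAt 𝓘(ℝ, E) (1 : G)).target) :
    ContMDiffAt 𝓘(ℝ, E) 𝓘(ℝ, E) ∞ (extChartAt 𝓘(ℝ, E) (1 : G)).symm x :=
  (contMDiffOn_extChartAt_symm (1 : G)).contMDiffAt ((isOpen_extChartAt_target (1 : G)).mem_nhds hx)

lemma contDiffAt_localMul {p : E × E} (h₁ : p.1 ∈ (extChartAt 𝓘(ℝ, E) (1 : G)).target)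
    (h₂ : p.2 ∈ (extChartAt 𝓘(ℝ, E) (1 : G)).target)
    (h : (extChartAt 𝓘(ℝ, E) (1 : G)).symm p.1 * (extChartAt 𝓘(ℝ, E) (1 : G)).symm p.2 ∈
      (chartAt E (1 : G)).source) : ContDiffAt ℝ ∞ (localMul E G) p := by
  refine contMDiffAt_iff_contDiffAt.1 ?_
  refine (contMDiffAt_extChartAt' h).comp p (I' := 𝓘(ℝ, E)) ?_
  exact ((contMDiffAt_extChartAt_one_symm E G h₁).comp p
      (contMDiffAt_iff_contDiffAt.2 contDiffAt_fst)).mul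
    ((contMDiffAt_extChartAt_one_symm E G h₂).comp p
      (contMDiffAt_iff_contDiffAt.2 contDiffAt_snd))

lemma contDiffAt_localConj {p : E × E} (h₁ : p.1 ∈ (extChartAt 𝓘(ℝ, E) (1 : G)).target)
    (h₂ : p.2 ∈ (extChartAt 𝓘(ℝ, E) (1 : G)).target)
    (h : (extChartAt 𝓘(ℝ, E) (1 : G)).symm p.1 * (extChartAt 𝓘(ℝ, E) (1 : G)).symm p.2 *
      ((extChartAt 𝓘(ℝ, E) (1 : G)).symm p.1)⁻¹ ∈
      (chartAt E (1 : G)).source) : ContDiffAt ℝ ∞ (localConj E G) p := by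
  refine contMDiffAt_iff_contDiffAt.1 ?_
  refine (contMDiffAt_extChartAt' h).comp p (I' := 𝓘(ℝ, E)) ?_
  have h3 := (contMDiffAt_extChartAt_one_symm E G h₁).comp p
      (contMDiffAt_iff_contDiffAt.2 contDiffAt_fst)
  exact (h3.mul ((contMDiffAt_extChartAt_one_symm E G h₂).comp p
      (contMDiffAt_iff_contDiffAt.2 contDiffAt_snd))).mul h3.inv

/-- Both sides are the derivative at `1` of conjugation by one fixed element, read in the chart, and
derivatives are unique. -/
lemma Ad_extChartAt_symm {x : E} (hx : x ∈ (extChartAt 𝓘(ℝ, E) (1 : G)).target) :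
    (Ad E ((extChartAt 𝓘(ℝ, E) (1 : G)).symm x) : E → E) =
      fderiv ℝ (localConj E G) (x, extChartAt 𝓘(ℝ, E) (1 : G) 1) ∘L
        ContinuousLinearMap.inr ℝ E E := by
  set g := (extChartAt 𝓘(ℝ, E) (1 : G)).symm x with hg
  have hs : ContMDiffAt 𝓘(ℝ, E) 𝓘(ℝ, E) ∞ (fun h : G => g * h * g⁻¹) 1 :=
    (contMDiffAt_const.mul contMDiffAt_id).mul contMDiffAt_const
  obtain ⟨D, hD⟩ : ∃ D : E →L[ℝ] E, D = mfderiv 𝓘(ℝ, E) 𝓘(ℝ, E) (fun h : G => g * h * g⁻¹) 1 :=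
    ⟨_, rfl⟩
  have h1 := hasFDerivAt_of_fix_one E G (hs.mdifferentiableAt (by simp)) (by simp) hD
  have h2 : DifferentiableAt ℝ (localConj E G) (x, extChartAt 𝓘(ℝ, E) (1 : G) 1) :=
    (contDiffAt_localConj E G hx (mem_extChartAt_target _) (by simp)).differentiableAt (by simp)
  have h3 := h2.hasFDerivAt.comp (f := fun y => (x, y)) (extChartAt 𝓘(ℝ, E) (1 : G) 1)
    ((hasFDerivAt_const x _).prodMk (hasFDerivAt_id _))
  have h4 := h1.unique h3
  exact congrArg (fun T : E →L[ℝ] E => (T : E → E)) (hD.symm.trans h4)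

/-- Pulling back along the inverse chart is pushing forward along the chart. The left invariant
field at `g` is the derivative at `1` of `h ↦ g * h` on `v`, so the chain rule leaves the derivative
of the local multiplication in its second variable. -/
lemma mpullback_mulInvariantVectorField_extChartAt {x : E}
    (hx : x ∈ (extChartAt 𝓘(ℝ, E) (1 : G)).target) (v : GroupLieAlgebra 𝓘(ℝ, E) G) :
    VectorField.mpullbackWithin 𝓘(ℝ, E) 𝓘(ℝ, E) (extChartAt 𝓘(ℝ, E) (1 : G)).symm
      (mulInvariantVectorField v) (Set.range 𝓘(ℝ, E)) x =
      fderiv ℝ (localMul E G) (x, extChartAt 𝓘(ℝ, E) (1 : G) 1) (0, v) := by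
  set g := (extChartAt 𝓘(ℝ, E) (1 : G)).symm x with hg
  have hgs : g ∈ (chartAt E (1 : G)).source := by
    have := (extChartAt 𝓘(ℝ, E) (1 : G)).map_target hx
    rwa [extChartAt_source] at this
  have hinv : (mfderivWithin 𝓘(ℝ, E) 𝓘(ℝ, E) (extChartAt 𝓘(ℝ, E) (1 : G)).symm
      (Set.range 𝓘(ℝ, E)) x).inverse = mfderiv 𝓘(ℝ, E) 𝓘(ℝ, E) (extChartAt 𝓘(ℝ, E) (1 : G)) g :=
    ContinuousLinearMap.inverse_eq (mfderivWithin_extChartAt_symm_comp_mfderiv_extChartAt hx)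
      (mfderiv_extChartAt_comp_mfderivWithin_extChartAt_symm hx)
  have h0 : MDifferentiableAt 𝓘(ℝ, E) 𝓘(ℝ, E) (fun h : G => g * h) 1 :=
    (contMDiff_mul_left (n := ∞)).mdifferentiableAt (by simp)
  have h0' : MDifferentiableAt 𝓘(ℝ, E) 𝓘(ℝ, E) (extChartAt 𝓘(ℝ, E) (1 : G)) (g * 1) := by
    rw [mul_one]
    exact (contMDiffAt_extChartAt' (n := ∞) hgs).mdifferentiableAt (by simp)
  obtain ⟨D, hD⟩ : ∃ D : E →L[ℝ] E, D = mfderiv 𝓘(ℝ, E) 𝓘(ℝ, E)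
    (extChartAt 𝓘(ℝ, E) (1 : G) ∘ fun h : G => g * h) 1 := ⟨_, rfl⟩
  have h1 := hasFDerivAt_writtenInExtChartAt (h0'.comp (1 : G) h0) hD
  have h2 : DifferentiableAt ℝ (localMul E G) (x, extChartAt 𝓘(ℝ, E) (1 : G) 1) :=
    (contDiffAt_localMul E G hx (mem_extChartAt_target _)
      (by simpa [hg] using hgs)).differentiableAt (by simp)
  have h3 := h2.hasFDerivAt.comp (f := fun y => (x, y)) (extChartAt 𝓘(ℝ, E) (1 : G) 1)
    ((hasFDerivAt_const x _).prodMk (hasFDerivAt_id _))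
  have h4 := h1.unique h3
  have h5 := hD.trans (mfderiv_comp (1 : G) h0' h0)
  rw [VectorField.mpullbackWithin_apply, hinv]
  have h6 := congrArg (fun T : E →L[ℝ] E => T v) h4
  have h7 := congrArg (fun T : E →L[ℝ] E => T v) h5
  have h8 : ∀ h, h = g → (mfderiv 𝓘(ℝ, E) 𝓘(ℝ, E) (extChartAt 𝓘(ℝ, E) (1 : G)) h : E →L[ℝ] E) =
    mfderiv 𝓘(ℝ, E) 𝓘(ℝ, E) (extChartAt 𝓘(ℝ, E) (1 : G)) g := by rintro h rfl; rfl
  have h9 := congrArg (fun T : E →L[ℝ] E => T (mulInvariantVectorField v g)) (h8 _ (mul_one g))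
  exact h9.symm.trans (h7.symm.trans h6)

/-- The Lie bracket of `𝔤` in terms of the mixed second derivative of the multiplication. -/
theorem lie_eq_of_hasFDerivAt [CompleteSpace E] {Q' : E →L[ℝ] E →L[ℝ] E}
    (hQ : HasFDerivAt (fun x => fderiv ℝ (localMul E G) (x, extChartAt 𝓘(ℝ, E) (1 : G) 1) ∘L
      ContinuousLinearMap.inr ℝ E E) Q' (extChartAt 𝓘(ℝ, E) (1 : G) 1))
    (v w : GroupLieAlgebra 𝓘(ℝ, E) G) : ⁅v, w⁆ = (Q' v w - Q' w v : E) := by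
  set x₀ := extChartAt 𝓘(ℝ, E) (1 : G) 1 with hx₀
  obtain ⟨X, hX⟩ : ∃ X : GroupLieAlgebra 𝓘(ℝ, E) G → E → E, X = fun v =>
    VectorField.mpullbackWithin 𝓘(ℝ, E) 𝓘(ℝ, E) (extChartAt 𝓘(ℝ, E) (1 : G)).symm
      (mulInvariantVectorField v) (Set.range 𝓘(ℝ, E)) := ⟨_, rfl⟩
  have hV : ∀ v, X v =ᶠ[𝓝 x₀] fun x => fderiv ℝ (localMul E G) (x, x₀) (0, v) := by
    intro v
    filter_upwards [extChartAt_target_mem_nhds (I := 𝓘(ℝ, E)) (1 : G)] with x hx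
    rw [hX]
    exact mpullback_mulInvariantVectorField_extChartAt E G hx v
  have hd : ∀ v : E, HasFDerivAt (fun x => fderiv ℝ (localMul E G) (x, x₀) (0, v)) (Q'.flip v) x₀ :=
    fun v => ((ContinuousLinearMap.apply ℝ E v).hasFDerivAt.comp x₀ hQ)
  have h0 : ∀ v : E, fderiv ℝ (localMul E G) (x₀, x₀) (0, v) = v := by
    intro v
    have hmem : x₀ ∈ (extChartAt 𝓘(ℝ, E) (1 : G)).target := mem_extChartAt_target _
    have h1 := ((contDiffAt_localMul E G (p := (x₀, x₀)) hmem hmem (by simp [hx₀])).differentiableAt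
      (by simp)).hasFDerivAt.comp (f := fun y => (x₀, y)) x₀
      ((hasFDerivAt_const x₀ x₀).prodMk (hasFDerivAt_id x₀))
    have h2 := (h1.congr_of_eventuallyEq ((localMul_one_left E G).mono fun x hx => hx.symm)).unique
      (hasFDerivAt_id x₀)
    exact DFunLike.congr_fun h2 v
  have h1 : ⁅v, w⁆ = (mfderiv 𝓘(ℝ, E) 𝓘(ℝ, E) (extChartAt 𝓘(ℝ, E) (1 : G)) 1).inverse
      (VectorField.lieBracketWithin ℝ (X v) (X w)
      ((extChartAt 𝓘(ℝ, E) (1 : G)).symm ⁻¹' Set.univ ∩ Set.range 𝓘(ℝ, E)) x₀ : E) := by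
    rw [GroupLieAlgebra.bracket_def, ← VectorField.mlieBracketWithin_univ,
      VectorField.mlieBracketWithin_apply, hX]
  -- The preferred chart at a point has identity differential at that point.
  have h2 : ∀ u, (mfderiv 𝓘(ℝ, E) 𝓘(ℝ, E) (extChartAt 𝓘(ℝ, E) (1 : G)) 1).inverse u = u := by
    intro u
    rw [mfderiv_extChartAt_self]
    exact congrArg (fun T : E →L[ℝ] E => T u) ContinuousLinearMap.inverse_id
  refine h1.trans ((h2 _).trans ?_)
  rw [Set.preimage_univ, Set.univ_inter, modelWithCornersSelf_coe, Set.range_id,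
    VectorField.lieBracketWithin_univ]
  -- At `x₀` the field `X v` has value `v` and derivative `Q'.flip v`, so the bracket of vector
  -- fields becomes the commutator of `Q'`.
  rw [(hV v).lieBracket_vectorField_eq (hV w), VectorField.lieBracket_eq]
  simp only [(hd v).fderiv, (hd w).fderiv]
  have e1 : Q'.flip w (fderiv ℝ (localMul E G) (x₀, x₀) (0, v)) = Q' v w :=
    congrArg (Q'.flip w) (h0 v)
  have e2 : Q'.flip v (fderiv ℝ (localMul E G) (x₀, x₀) (0, w)) = Q' w v :=
    congrArg (Q'.flip v) (h0 w)
  exact congrArg₂ (fun a b : E => a - b) e1 e2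

/-- The differential at `1` of the adjoint representation, in the preferred chart at `1`. -/
theorem exists_hasFDerivAt_Ad [CompleteSpace E] : ∃ (A : E → E →L[ℝ] E) (A' : E →L[ℝ] E →L[ℝ] E),
    HasFDerivAt A A' (extChartAt 𝓘(ℝ, E) (1 : G) 1) ∧
    (∀ x ∈ (extChartAt 𝓘(ℝ, E) (1 : G)).target,
      (Ad E ((extChartAt 𝓘(ℝ, E) (1 : G)).symm x) : E → E) = A x) ∧
    ∀ v w : GroupLieAlgebra 𝓘(ℝ, E) G, A' v w = ⁅v, w⁆ := by
  set x₀ := extChartAt 𝓘(ℝ, E) (1 : G) 1 with hx₀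
  have hmem : x₀ ∈ (extChartAt 𝓘(ℝ, E) (1 : G)).target := mem_extChartAt_target _
  have hnear := extChartAt_target_mem_nhds (I := 𝓘(ℝ, E)) (1 : G)
  have hMC : ∀ᶠ p in 𝓝 (x₀, x₀), localMul E G (localConj E G p, p.1) = localMul E G p := by
    have := topologicalGroup_of_lieGroup 𝓘(ℝ, E) ∞ (G := G)
    have hc : Filter.Tendsto (extChartAt 𝓘(ℝ, E) (1 : G)).symm (𝓝 x₀)
        (𝓝 ((extChartAt 𝓘(ℝ, E) (1 : G)).symm x₀)) := continuousAt_extChartAt_symm _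
    have hc₁ := hc.comp (continuousAt_fst (p := (x₀, x₀)))
    have hc₂ := hc.comp (continuousAt_snd (p := (x₀, x₀)))
    have h1 : ContinuousAt (fun p : E × E => (extChartAt 𝓘(ℝ, E) (1 : G)).symm p.1 *
        (extChartAt 𝓘(ℝ, E) (1 : G)).symm p.2 * ((extChartAt 𝓘(ℝ, E) (1 : G)).symm p.1)⁻¹)
        (x₀, x₀) :=
      (hc₁.mul hc₂).mul hc₁.inv
    have h2 : (extChartAt 𝓘(ℝ, E) (1 : G)).source ∈ 𝓝 ((extChartAt 𝓘(ℝ, E) (1 : G)).symm x₀ *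
        (extChartAt 𝓘(ℝ, E) (1 : G)).symm x₀ * ((extChartAt 𝓘(ℝ, E) (1 : G)).symm x₀)⁻¹) := by
      simpa only [hx₀, extChartAt_to_inv, mul_one, inv_one] using
        extChartAt_source_mem_nhds (I := 𝓘(ℝ, E)) (1 : G)
    -- The identity `(g h g⁻¹) g = g h` passes to the chart once the conjugate lies in the chart
    -- domain.
    filter_upwards [h1 h2] with p hp
    have h3 := (extChartAt 𝓘(ℝ, E) (1 : G)).left_inv hp
    simp only [localMul, localConj, h3, inv_mul_cancel_right]
  have hM₁ : ∀ᶠ x in 𝓝 x₀, localMul E G (x, x₀) = x := by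
    filter_upwards [hnear] with x hx
    simp only [localMul, hx₀, extChartAt_to_inv, mul_one]
    exact (extChartAt 𝓘(ℝ, E) (1 : G)).right_inv hx
  have hC₀ : ∀ᶠ x in 𝓝 x₀, localConj E G (x, x₀) = x₀ := by
    refine Filter.Eventually.of_forall fun x => ?_
    simp only [localConj, hx₀, extChartAt_to_inv, mul_one, mul_inv_cancel]
  obtain ⟨A', Q', hA, hQ, h⟩ := hasFDerivAt_conjugation (M := localMul E G) (C := localConj E G)
    (x₀ := x₀) (contDiffAt_localMul E G hmem hmem (by simp [hx₀]))
    (contDiffAt_localConj E G hmem hmem (by simp [hx₀])) hMC hM₁ (localMul_one_left E G) hC₀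
  exact ⟨_, A', hA, fun x hx => Ad_extChartAt_symm E G hx, fun v w =>
    (h v w).trans (lie_eq_of_hasFDerivAt E G hQ v w).symm⟩

end Adjoint

/-! ### The Cartan decomposition -/

section Cartan

/-- A skew-symmetric endomorphism of a Euclidean space vanishes if the trace of its square does. -/
theorem eq_zero_of_skew_of_trace_eq_zero {V : Type*} [AddCommGroup V] [Module ℝ V]
    [FiniteDimensional ℝ V] (B : V →ₗ[ℝ] V →ₗ[ℝ] ℝ) (hsymm : ∀ x y, B x y = B y x)
    (hpos : ∀ x, x ≠ 0 → 0 < B x x) {A : V →ₗ[ℝ] V} (hA : ∀ x y, B (A x) y + B x (A y) = 0)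
    (htr : LinearMap.trace ℝ V (A ∘ₗ A) = 0) : A = 0 := by
  have hnn : ∀ x, 0 ≤ B x x := by
    intro x
    by_cases hx : x = 0
    · simp [hx]
    · exact (hpos x hx).le
  -- The form `B` is made the inner product, so that traces can be computed in an orthonormal basis.
  let core : InnerProductSpace.Core ℝ V :=
    { inner := fun x y => B x y
      conj_inner_symm := fun x y => by simp [hsymm x y]
      re_inner_nonneg := fun x => by simpa using hnn x
      add_left := fun x y z => by simp
      smul_left := fun x y r => by simp
      definite := fun x hx => by
        by_contra h
        exact (hpos x h).ne' hx }
  let _ : NormedAddCommGroup V := core.toNormedAddCommGroup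
  let _ : InnerProductSpace ℝ V := InnerProductSpace.ofCore core.toCore
  have hinner : ∀ x y : V, inner ℝ x y = B x y := fun _ _ => rfl
  rw [LinearMap.trace_eq_sum_inner _ (stdOrthonormalBasis ℝ V)] at htr
  -- By skewness `tr A² = -∑ B (A eᵢ) (A eᵢ)`, a sum of terms of one sign; its vanishing kills every
  -- `A eᵢ`.
  have h1 : ∀ i, inner ℝ (stdOrthonormalBasis ℝ V i) ((A ∘ₗ A) (stdOrthonormalBasis ℝ V i)) =
      - B (A (stdOrthonormalBasis ℝ V i)) (A (stdOrthonormalBasis ℝ V i)) := by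
    intro i
    rw [hinner, LinearMap.comp_apply]
    linarith [hA (stdOrthonormalBasis ℝ V i) (A (stdOrthonormalBasis ℝ V i))]
  simp only [h1, Finset.sum_neg_distrib, neg_eq_zero] at htr
  rw [Finset.sum_eq_zero_iff_of_nonneg (fun i _ => hnn _)] at htr
  refine (stdOrthonormalBasis ℝ V).toBasis.ext fun i => ?_
  simp only [OrthonormalBasis.coe_toBasis, LinearMap.zero_apply]
  by_contra h
  exact (hpos _ h).ne' (htr i (Finset.mem_univ i))

/-! ### The adjoint action of a compact subgroup -/

variable (E : Type*) [NormedAddCommGroup E] [NormedSpace ℝ E]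
  {G : Type*} [TopologicalSpace G] [ChartedSpace E G] [Group G]

/-- The adjoint action, as an endomorphism of the model space. -/
def AdModel (g : G) : E →ₗ[ℝ] E := Ad E g

lemma AdModel_one : AdModel E (1 : G) = LinearMap.id := by
  have h1 : (fun x : G => 1 * x * 1⁻¹) = id := by ext x; simp
  have h2 : mfderiv 𝓘(ℝ, E) 𝓘(ℝ, E) (fun x : G => 1 * x * 1⁻¹) 1 =
    mfderiv 𝓘(ℝ, E) 𝓘(ℝ, E) (id : G → G) 1 := by rw [h1]
  ext v
  exact (congrArg (fun T : E →L[ℝ] E => T v) h2).trans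
    (congrArg (fun T : E →L[ℝ] E => T v) (mfderiv_id (I := 𝓘(ℝ, E)) (x := (1 : G))))

lemma hasDerivAt_extChartAt_comp {c : ℝ → G} (hc : ContMDiffAt 𝓘(ℝ, ℝ) 𝓘(ℝ, E) ∞ c 0)
    (hc0 : c 0 = 1) {v : E} (hv : (mfderiv 𝓘(ℝ, ℝ) 𝓘(ℝ, E) c 0 : ℝ →L[ℝ] E) 1 = v) :
    HasDerivAt (fun t => extChartAt 𝓘(ℝ, E) (1 : G) (c t)) v 0 := by
  obtain ⟨D, hD⟩ : ∃ D : ℝ →L[ℝ] E, D = mfderiv 𝓘(ℝ, ℝ) 𝓘(ℝ, E) c 0 := ⟨_, rfl⟩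
  have h := hasFDerivAt_writtenInExtChartAt (hc.mdifferentiableAt (by simp)) hD
  rw [hc0] at h
  have h1 := h.hasDerivAt
  have h2 : D 1 = v := hD ▸ hv
  rw [h2] at h1
  exact h1

variable [LieGroup 𝓘(ℝ, E) ∞ G]

lemma mdifferentiable_conj (g : G) :
    MDifferentiable 𝓘(ℝ, E) 𝓘(ℝ, E) (fun h : G => g * h * g⁻¹) := fun _ =>
  ((contMDiffAt_const.mul contMDiffAt_id).mul contMDiffAt_const :
    ContMDiffAt 𝓘(ℝ, E) 𝓘(ℝ, E) ∞ (fun h : G => g * h * g⁻¹) _).mdifferentiableAt (by simp)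

lemma AdModel_mul_apply (g h : G) (v : E) :
    AdModel E (g * h) v = AdModel E g (AdModel E h v) := by
  have h1 : (fun x : G => g * h * x * (g * h)⁻¹) =
      (fun x => g * x * g⁻¹) ∘ (fun x => h * x * h⁻¹) := by
    ext x; simp [mul_assoc]
  have h2 := mfderiv_comp_apply_of_eq (x := (1 : G)) (y := 1) (mdifferentiable_conj E g 1)
    (mdifferentiable_conj E h 1) (by simp) v
  rw [← h1] at h2
  exact h2

lemma exists_hasFDerivAt_AdModel [CompleteSpace E] :
    ∃ (A : E → E →L[ℝ] E) (A' : E →L[ℝ] E →L[ℝ] E),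
    HasFDerivAt A A' (extChartAt 𝓘(ℝ, E) (1 : G) 1) ∧
    (∀ g ∈ (extChartAt 𝓘(ℝ, E) (1 : G)).source, ∀ v,
      AdModel E g v = A (extChartAt 𝓘(ℝ, E) (1 : G) g) v) ∧
    ∀ v w : GroupLieAlgebra 𝓘(ℝ, E) G, A' v w = ⁅v, w⁆ := by
  obtain ⟨A, A', hA, hAd, hA'⟩ := exists_hasFDerivAt_Ad E G
  refine ⟨A, A', hA, fun g hg v => ?_, hA'⟩
  have h3 := congrFun (hAd _ ((extChartAt 𝓘(ℝ, E) (1 : G)).map_source hg)) v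
  rw [(extChartAt 𝓘(ℝ, E) (1 : G)).left_inv hg] at h3
  exact h3

/-- Near `1` this follows from differentiability in the chart; elsewhere from `Ad x = Ad g ∘ Ad (g⁻¹
x)`. -/
lemma continuous_AdModel_apply [FiniteDimensional ℝ E] (v : E) :
    Continuous fun g : G => AdModel E g v := by
  have := FiniteDimensional.complete ℝ E
  have := topologicalGroup_of_lieGroup 𝓘(ℝ, E) ∞ (G := G)
  obtain ⟨A, A', hA, hAd, -⟩ := exists_hasFDerivAt_AdModel E (G := G)
  have h1 : ContinuousAt (fun g : G => AdModel E g v) 1 := by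
    have h2 : ContinuousAt (fun g : G => A (extChartAt 𝓘(ℝ, E) (1 : G) g) v) 1 :=
      ((ContinuousLinearMap.apply ℝ E v).continuous.continuousAt.comp hA.continuousAt).comp
        (f := extChartAt 𝓘(ℝ, E) (1 : G)) (continuousAt_extChartAt (1 : G))
    refine h2.congr ?_
    filter_upwards [extChartAt_source_mem_nhds (I := 𝓘(ℝ, E)) (1 : G)] with g hg
    exact (hAd g hg v).symm
  refine continuous_iff_continuousAt.2 fun g => ?_
  have h2 : Continuous (AdModel E g) := LinearMap.continuous_of_finiteDimensional _
  have h3 : ContinuousAt (fun x : G => g⁻¹ * x) g := (continuous_const_mul _).continuousAt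
  have h4 : ContinuousAt (fun x : G => AdModel E (g⁻¹ * x) v) g := by
    have h5 : ContinuousAt (fun x : G => AdModel E x v) (g⁻¹ * g) := by rwa [inv_mul_cancel]
    exact h5.comp (f := fun x : G => g⁻¹ * x) h3
  refine (h2.continuousAt.comp h4).congr (Filter.Eventually.of_forall fun x => ?_)
  have := AdModel_mul_apply E g (g⁻¹ * x) v
  rw [mul_inv_cancel_left] at this
  exact this.symm

open MeasureTheory in
/-- A compact group of a Lie group preserves an inner product on the Lie algebra. -/
theorem exists_AdModel_invariant_bilinForm [FiniteDimensional ℝ E] [T2Space G] (K : Subgroup G)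
    [CompactSpace K] : ∃ B : E →ₗ[ℝ] E →ₗ[ℝ] ℝ, (∀ x y, B x y = B y x) ∧ (∀ x, x ≠ 0 → 0 < B x x) ∧
      ∀ k ∈ K, ∀ x y : E, B (AdModel E k x) (AdModel E k y) = B x y := by
  have := topologicalGroup_of_lieGroup 𝓘(ℝ, E) ∞ (G := G)
  let _ : MeasurableSpace K := borel K
  have : BorelSpace K := ⟨rfl⟩
  set b := Module.finBasis ℝ E
  set Q : E → E → ℝ := fun x y => ∑ i, b.repr x i * b.repr y i with hQ
  have hQc : ∀ i, Continuous fun x : E => b.repr x i := fun i =>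
    LinearMap.continuous_of_finiteDimensional (b.coord i)
  -- The coordinate dot product, moved by `k⁻¹` rather than `k` so that left invariance of Haar
  -- measure gives the invariance of the average.
  set q : E → E → K → ℝ := fun x y k => Q (AdModel E (k⁻¹ : G) x) (AdModel E (k⁻¹ : G) y) with hq
  have hqc : ∀ x y, Continuous (q x y) := by
    intro x y
    have h1 : ∀ z : E, Continuous fun k : K => (AdModel E (k⁻¹ : G) z : E) := fun z =>
      (continuous_AdModel_apply E z).comp (continuous_subtype_val.inv)
    exact continuous_finsetSum _ fun i _ => ((hQc i).comp (h1 x)).mul ((hQc i).comp (h1 y))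
  set μ : Measure K := Measure.haar
  have hint : ∀ x y, Integrable (q x y) μ := fun x y =>
    (hqc x y).integrable_of_hasCompactSupport (HasCompactSupport.of_compactSpace _)
  refine ⟨LinearMap.mk₂ ℝ (fun x y => ∫ k, q x y k ∂μ) ?_ ?_ ?_ ?_, ?_, ?_, ?_⟩
  · intro x x' y
    rw [← integral_add (hint _ _) (hint _ _)]
    congr 1; ext k
    have h1 : (AdModel E (k⁻¹ : G) (x + x') : E) =
      AdModel E (k⁻¹ : G) x + AdModel E (k⁻¹ : G) x' := map_add _ _ _
    simp only [hq, hQ, h1, map_add, Finsupp.add_apply, add_mul, Finset.sum_add_distrib]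
  · intro c x y
    rw [smul_eq_mul, ← integral_const_mul]
    congr 1; ext k
    have h1 : (AdModel E (k⁻¹ : G) (c • x) : E) = c • AdModel E (k⁻¹ : G) x := map_smul _ _ _
    simp only [hq, hQ, h1, map_smul, Finsupp.smul_apply, smul_eq_mul, Finset.mul_sum, mul_assoc]
  · intro x y y'
    rw [← integral_add (hint _ _) (hint _ _)]
    congr 1; ext k
    have h1 : (AdModel E (k⁻¹ : G) (y + y') : E) =
      AdModel E (k⁻¹ : G) y + AdModel E (k⁻¹ : G) y' := map_add _ _ _
    simp only [hq, hQ, h1, map_add, Finsupp.add_apply, mul_add, Finset.sum_add_distrib]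
  · intro c x y
    rw [smul_eq_mul, ← integral_const_mul]
    congr 1; ext k
    have h1 : (AdModel E (k⁻¹ : G) (c • y) : E) = c • AdModel E (k⁻¹ : G) y := map_smul _ _ _
    simp only [hq, hQ, h1, map_smul, Finsupp.smul_apply, smul_eq_mul, Finset.mul_sum,
      mul_left_comm]
  · intro x y
    simp only [LinearMap.mk₂_apply]
    simp only [hq, hQ, mul_comm]
  · intro x hx
    rw [LinearMap.mk₂_apply]
    -- The integrand is continuous, nonnegative, and nonzero at `k = 1`, where `Ad` is the identity.
    refine (hqc x x).integral_pos_of_hasCompactSupport_nonneg_nonzero (x := 1)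
      (HasCompactSupport.of_compactSpace _) (fun k => Finset.sum_nonneg fun i _ =>
        mul_self_nonneg _) ?_
    intro h0
    have h1 : ∀ z : E, (AdModel E ((1 : K) : G)⁻¹ z : E) = z := by
      intro z
      rw [OneMemClass.coe_one, inv_one]
      rw [AdModel_one]; rfl
    simp only [hq, hQ, h1] at h0
    rw [Finset.sum_eq_zero_iff_of_nonneg (fun i _ => mul_self_nonneg _)] at h0
    refine hx (b.repr.map_eq_zero_iff.1 (Finsupp.ext fun i => ?_))
    simpa using h0 i (Finset.mem_univ i)
  · intro k hk x y
    simp only [LinearMap.mk₂_apply]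
    rw [← integral_mul_left_eq_self (q x y) (⟨k, hk⟩⁻¹ : K)]
    refine integral_congr_ae (Filter.Eventually.of_forall fun k' => ?_)
    have h1 : ∀ z : E, AdModel E (k'⁻¹ : G) (AdModel E k z) =
        AdModel E (((⟨k, hk⟩⁻¹ * k' : K) : G)⁻¹) z := by
      intro z
      rw [← AdModel_mul_apply]
      simp
    simp only [hq, h1]

/-- A compact subgroup `K` preserves an inner product on `𝔤`, for which `Lie K` acts by
skew-symmetric endomorphisms. -/
theorem exists_skew_of_mem_lieSubspace [FiniteDimensional ℝ E] [CompleteSpace E] [T2Space G]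
    (K : Subgroup G) [CompactSpace K] :
    ∃ (B : E →ₗ[ℝ] E →ₗ[ℝ] ℝ) (A' : E →L[ℝ] E →L[ℝ] E), (∀ x y, B x y = B y x) ∧
      (∀ x, x ≠ 0 → 0 < B x x) ∧ (∀ v w : GroupLieAlgebra 𝓘(ℝ, E) G, A' v w = ⁅v, w⁆) ∧
      ∀ v ∈ lieSubspace E K, ∀ x y : E, B (A' v x) y + B x (A' v y) = 0 := by
  obtain ⟨B, hsymm, hpos, hB⟩ := exists_AdModel_invariant_bilinForm E K
  obtain ⟨A, A', hA, hAd, hA'⟩ := exists_hasFDerivAt_AdModel E (G := G)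
  refine ⟨B, A', hsymm, hpos, hA', ?_⟩
  -- Skewness is a linear condition on `v`, so it suffices to check it on the velocities spanning
  -- `lieSubspace E K`.
  let S : Submodule ℝ E :=
    { carrier := {v | ∀ x y : E, B (A' v x) y + B x (A' v y) = 0}
      zero_mem' := fun x y => by simp
      add_mem' := fun {v w} hv hw x y => by
        have h1 := hv x y
        have h2 := hw x y
        simp only [map_add, _root_.add_apply, LinearMap.add_apply]
        linarith
      smul_mem' := fun c v hv x y => by
        have h1 := hv x y
        simp only [map_smul, _root_.smul_apply, LinearMap.smul_apply, smul_eq_mul]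
        linear_combination c * h1 }
  refine fun v hv => (Submodule.span_le (p := S)).2 ?_ hv
  rintro v ⟨c, hc0, hc, hcK, hcv⟩ x y
  have hγ := hasDerivAt_extChartAt_comp E hc hc0 hcv
  have hAγ : ∀ z : E, HasDerivAt (fun t => A (extChartAt 𝓘(ℝ, E) (1 : G) (c t)) z) (A' v z) 0 := by
    intro z
    have h1 : HasFDerivAt A A' (extChartAt 𝓘(ℝ, E) (1 : G) (c 0)) := by rwa [hc0]
    have h2 := h1.comp_hasDerivAt 0 hγ
    exact (ContinuousLinearMap.apply ℝ E z).hasFDerivAt.comp_hasDerivAt 0 h2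
  have hcA : ∀ᶠ t in 𝓝 (0 : ℝ), ∀ z : E,
      AdModel E (c t) z = A (extChartAt 𝓘(ℝ, E) (1 : G) (c t)) z := by
    have h1 : (extChartAt 𝓘(ℝ, E) (1 : G)).source ∈ 𝓝 (c 0) := by
      rw [hc0]; exact extChartAt_source_mem_nhds (1 : G)
    filter_upwards [hc.continuousAt h1] with t ht z
    exact hAd _ ht z
  have hA0 : ∀ z : E, A (extChartAt 𝓘(ℝ, E) (1 : G) (c 0)) z = z := by
    intro z
    rw [← hcA.self_of_nhds z, hc0, AdModel_one]
    rfl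
  -- The function `t ↦ B (Ad (c t) x) (Ad (c t) y)` is constant near `0`; its derivative at `0`,
  -- computed by the product rule, is the skewness relation.
  have hd := (B.toContinuousBilinearMap).hasFDerivAt_of_bilinear (hAγ x).hasFDerivAt
    (hAγ y).hasFDerivAt
  have hconst : (fun t => B.toContinuousBilinearMap (A (extChartAt 𝓘(ℝ, E) (1 : G) (c t)) x)
      (A (extChartAt 𝓘(ℝ, E) (1 : G) (c t)) y)) =ᶠ[𝓝 0] fun _ => B x y := by
    filter_upwards [hcK, hcA] with t htK htA
    rw [← htA, ← htA]
    exact hB _ htK x y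
  have h0 := (hd.congr_of_eventuallyEq hconst.symm).unique (hasFDerivAt_const _ _)
  have h1 := DFunLike.congr_fun h0 (1 : ℝ)
  simp only [_root_.add_apply, ContinuousLinearMap.precompR_apply,
    ContinuousLinearMap.compL_apply, ContinuousLinearMap.coe_comp, Function.comp_apply,
    ContinuousLinearMap.precompL_apply, hA0, ContinuousLinearMap.toSpanSingleton_apply, one_smul,
    LinearMap.toContinuousBilinearMap_apply, _root_.zero_apply] at h1
  rw [add_comm]
  exact h1

/-- The decomposition `𝔤 = 𝔭 ⊕ 𝔨` for a compact subgroup of a semisimple group. -/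
theorem isCompl_cartanP [FiniteDimensional ℝ E] [CompleteSpace E] [T2Space G]
    (hsimple : LieAlgebra.IsSimple ℝ (GroupLieAlgebra 𝓘(ℝ, E) G))
    (K : Subgroup G) [CompactSpace K] : IsCompl (cartanP E K) (lieSubspace E K) := by
  have hfin : FiniteDimensional ℝ (GroupLieAlgebra 𝓘(ℝ, E) G) :=
    inferInstanceAs (FiniteDimensional ℝ E)
  obtain ⟨B, A', hsymm, hpos, hA', hskew⟩ := exists_skew_of_mem_lieSubspace E K
  -- For a reflexive form in finite dimension, a subspace meeting its orthogonal trivially is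
  -- complementary to it.
  refine IsCompl.symm ((LinearMap.BilinForm.isCompl_orthogonal_iff_disjoint ?_).2 ?_)
  · intro x y h
    rw [LieModule.traceForm_comm]
    exact h
  rw [Submodule.disjoint_def]
  intro x hx hxo
  have h1 : killingForm ℝ (GroupLieAlgebra 𝓘(ℝ, E) G) x x = 0 := hxo x hx
  rw [killingForm_apply_apply] at h1
  have h2 : LieAlgebra.ad ℝ (GroupLieAlgebra 𝓘(ℝ, E) G) x = (A' x).toLinearMap :=
    LinearMap.ext fun w => (hA' x w).symm
  rw [h2] at h1
  have h3 := eq_zero_of_skew_of_trace_eq_zero B hsymm hpos (A := (A' x).toLinearMap)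
    (hskew x hx) h1
  -- Now `ad x = 0`, so `x` is central, and the center of a simple Lie algebra is trivial.
  have h4 : x ∈ LieModule.ker ℝ (GroupLieAlgebra 𝓘(ℝ, E) G) (GroupLieAlgebra 𝓘(ℝ, E) G) :=
    (LieModule.mem_ker _ _ _ _).2 fun w => (hA' x w).symm.trans (LinearMap.congr_fun h3 w)
  rw [LieAlgebra.self_module_ker_eq_center,
    LieAlgebra.center_eq_bot] at h4
  exact (LieSubmodule.mem_bot x).1 h4

end Cartan

/-! ### Logarithmic derivatives -/

section ModelDeriv

variable {E₁ E₂ E₃ H₁ H₂ H₃ : Type*} [NormedAddCommGroup E₁] [NormedSpace ℝ E₁]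
  [NormedAddCommGroup E₂] [NormedSpace ℝ E₂] [NormedAddCommGroup E₃] [NormedSpace ℝ E₃]
  [TopologicalSpace H₁] [TopologicalSpace H₂] [TopologicalSpace H₃]
  (I₁ : ModelWithCorners ℝ E₁ H₁) (I₂ : ModelWithCorners ℝ E₂ H₂) (I₃ : ModelWithCorners ℝ E₃ H₃)
  {M₁ M₂ M₃ : Type*} [TopologicalSpace M₁] [ChartedSpace H₁ M₁] [TopologicalSpace M₂]
  [ChartedSpace H₂ M₂] [TopologicalSpace M₃] [ChartedSpace H₃ M₃]

/-- The differential of a map of manifolds, as a linear map of the model spaces. -/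
def modelDeriv (f : M₁ → M₂) (x : M₁) : E₁ →L[ℝ] E₂ := mfderiv I₁ I₂ f x

variable {I₁ I₂ I₃}

lemma modelDeriv_comp {g : M₂ → M₃} {f : M₁ → M₂} {x : M₁} (hg : MDifferentiableAt I₂ I₃ g (f x))
    (hf : MDifferentiableAt I₁ I₂ f x) :
    modelDeriv I₁ I₃ (fun y => g (f y)) x = modelDeriv I₂ I₃ g (f x) ∘L modelDeriv I₁ I₂ f x :=
  mfderiv_comp x hg hf

lemma modelDeriv_congr {f g : M₁ → M₂} {x : M₁} (h : f =ᶠ[𝓝 x] g) :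
    modelDeriv I₁ I₂ f x = modelDeriv I₁ I₂ g x :=
  h.mfderiv_eq

lemma modelDeriv_id (x : M₁) :
    modelDeriv I₁ I₁ (fun y => y) x = ContinuousLinearMap.id ℝ E₁ :=
  mfderiv_id

lemma modelDeriv_prodMk {f : M₁ → M₂} {g : M₁ → M₃} {x : M₁} (hf : MDifferentiableAt I₁ I₂ f x)
    (hg : MDifferentiableAt I₁ I₃ g x) :
    modelDeriv I₁ (I₂.prod I₃) (fun y => (f y, g y)) x =
      (modelDeriv I₁ I₂ f x).prod (modelDeriv I₁ I₃ g x) :=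
  mfderiv_prodMk hf hg

lemma modelDeriv_prod_apply {f : M₁ × M₂ → M₃} {x : M₁ × M₂}
    (hf : MDifferentiableAt (I₁.prod I₂) I₃ f x) (v : E₁ × E₂) :
    modelDeriv (I₁.prod I₂) I₃ f x v = modelDeriv I₁ I₃ (fun y => f (y, x.2)) x.1 v.1 +
      modelDeriv I₂ I₃ (fun y => f (x.1, y)) x.2 v.2 :=
  mfderiv_prod_eq_add_apply hf

end ModelDeriv

/-! ### Logarithmic derivatives modulo `𝔨` -/

section LogDeriv

variable {B B' : Type*} (E : Type*) [NormedAddCommGroup B] [NormedSpace ℝ B]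
  [NormedAddCommGroup B'] [NormedSpace ℝ B']
  [NormedAddCommGroup E] [NormedSpace ℝ E] {Y G : Type*} [TopologicalSpace Y] [ChartedSpace B Y]
  [TopologicalSpace G] [ChartedSpace E G] [Group G]

variable (B) in
/-- The logarithmic derivative at `y` of a map to a Lie group. -/
def logDeriv (a : Y → G) (y : Y) : B →L[ℝ] E :=
  modelDeriv 𝓘(ℝ, B) 𝓘(ℝ, E) (fun y' => (a y)⁻¹ * a y') y

/-- The constant cancels in `(a y)⁻¹ * a y'`. Such a constant is the change in the second component
of a lift to `A × G` under a deck transformation. -/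
lemma logDeriv_const_mul (a : Y → G) (g : G) (y : Y) :
    logDeriv B E (fun y' => g * a y') y = logDeriv B E a y := by
  simp only [logDeriv, mul_inv_rev, mul_assoc, inv_mul_cancel_left]

/-- Every `v` is the velocity of a straight line in the chart at `y`, and `k` maps this line to a
curve in `K` through `1`. -/
lemma modelDeriv_mem_lieSubspace {K : Subgroup G} {k : Y → G} {y : Y} [IsManifold 𝓘(ℝ, B) ∞ Y]
    (hk : ContMDiffAt 𝓘(ℝ, B) 𝓘(ℝ, E) ∞ k y) (hky : k y = 1) (hkK : ∀ᶠ y' in 𝓝 y, k y' ∈ K)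
    (v : B) : modelDeriv 𝓘(ℝ, B) 𝓘(ℝ, E) k y v ∈ lieSubspace E K := by
  set e := extChartAt 𝓘(ℝ, B) y with he
  set l : ℝ → B := fun t => e y + t • v with hl
  have hl0 : l 0 = e y := by simp [hl]
  have hey : e.symm (l 0) = y := by rw [hl0, he, extChartAt_to_inv]
  have hls : ContDiffAt ℝ ∞ l 0 := contDiffAt_const.add (contDiffAt_id.smul contDiffAt_const)
  have hes : ContMDiffAt 𝓘(ℝ, B) 𝓘(ℝ, B) ∞ e.symm (l 0) := by
    rw [hl0]
    exact (contMDiffOn_extChartAt_symm y).contMDiffAt (extChartAt_target_mem_nhds y)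
  have hcs : ContMDiffAt 𝓘(ℝ, ℝ) 𝓘(ℝ, B) ∞ (fun t => e.symm (l t)) 0 :=
    hes.comp (0 : ℝ) hls.contMDiffAt
  have hc : ContMDiffAt 𝓘(ℝ, ℝ) 𝓘(ℝ, E) ∞ (fun t => k (e.symm (l t))) 0 := by
    have h1 : ContMDiffAt 𝓘(ℝ, B) 𝓘(ℝ, E) ∞ k (e.symm (l 0)) := by rwa [hey]
    exact h1.comp (0 : ℝ) hcs
  have hc0 : k (e.symm (l 0)) = 1 := by rw [hey, hky]
  refine Submodule.subset_span ⟨fun t => k (e.symm (l t)), hc0, hc, ?_, ?_⟩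
  · have h1 : Filter.Tendsto (fun t => e.symm (l t)) (𝓝 0) (𝓝 y) := by
      have := hcs.continuousAt.tendsto
      rwa [hey] at this
    exact h1.eventually hkK
  · have h1 := hasDerivAt_extChartAt_comp E hc hc0 rfl
    have h2 := hasFDerivAt_writtenInExtChartAt (hk.mdifferentiableAt (by simp))
      (D := modelDeriv 𝓘(ℝ, B) 𝓘(ℝ, E) k y) rfl
    rw [hky, ← he, ← hl0] at h2
    have h3 : HasDerivAt l v 0 := by
      simpa [hl] using ((hasDerivAt_id (0 : ℝ)).smul_const v).const_add (e y)
    exact h1.unique (h2.comp_hasDerivAt 0 h3)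

variable [LieGroup 𝓘(ℝ, E) ∞ G]

lemma mdifferentiable_const_mul (g : G) : MDifferentiable 𝓘(ℝ, E) 𝓘(ℝ, E) (fun h : G => g * h) :=
  fun _ => (contMDiffAt_const.mul contMDiffAt_id : ContMDiffAt 𝓘(ℝ, E) 𝓘(ℝ, E) ∞
    (fun h : G => g * h) _).mdifferentiableAt (by simp)

lemma logDeriv_eq_maurerCartan {a : Y → G} {y : Y}
    (ha : MDifferentiableAt 𝓘(ℝ, B) 𝓘(ℝ, E) a y) (v : B) :
    logDeriv B E a y v = maurerCartan E (a y) (modelDeriv 𝓘(ℝ, B) 𝓘(ℝ, E) a y v) :=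
  DFunLike.congr_fun (modelDeriv_comp (mdifferentiable_const_mul E _ _) ha) v

/-- At `(1, 1)` both partial derivatives of the multiplication are the identity. -/
lemma modelDeriv_mul {f k : Y → G} {y : Y} (hf : MDifferentiableAt 𝓘(ℝ, B) 𝓘(ℝ, E) f y)
    (hk : MDifferentiableAt 𝓘(ℝ, B) 𝓘(ℝ, E) k y) (hf1 : f y = 1) (hk1 : k y = 1) :
    modelDeriv 𝓘(ℝ, B) 𝓘(ℝ, E) (fun y' => f y' * k y') y =
      modelDeriv 𝓘(ℝ, B) 𝓘(ℝ, E) f y + modelDeriv 𝓘(ℝ, B) 𝓘(ℝ, E) k y := by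
  have hm : MDifferentiable (𝓘(ℝ, E).prod 𝓘(ℝ, E)) 𝓘(ℝ, E) (fun p : G × G => p.1 * p.2) :=
    (contMDiff_mul 𝓘(ℝ, E) ∞).mdifferentiable (by simp)
  ext v
  rw [modelDeriv_comp (hm _) (hf.prodMk hk), ContinuousLinearMap.comp_apply,
    modelDeriv_prod_apply (hm _), modelDeriv_prodMk hf hk]
  simp only [hf1, hk1, mul_one, one_mul, modelDeriv_id]
  rfl

/-- Since `a y = b y`, one has `(b y)⁻¹ b = ((a y)⁻¹ a) (a⁻¹ b)`, with both factors equal to `1` at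
`y` and the second one `K`-valued. The differential of the product is the sum, and the second term
lies in `𝔨`. -/
lemma logDeriv_sub_mem {K : Subgroup G} {a b : Y → G} {y : Y} [IsManifold 𝓘(ℝ, B) ∞ Y]
    (ha : ContMDiffAt 𝓘(ℝ, B) 𝓘(ℝ, E) ∞ a y) (hb : ContMDiffAt 𝓘(ℝ, B) 𝓘(ℝ, E) ∞ b y)
    (hab : a y = b y) (hK : ∀ᶠ y' in 𝓝 y, (a y')⁻¹ * b y' ∈ K) (v : B) :
    logDeriv B E b y v - logDeriv B E a y v ∈ lieSubspace E K := by
  have hk : ContMDiffAt 𝓘(ℝ, B) 𝓘(ℝ, E) ∞ (fun y' => (a y')⁻¹ * b y') y := ha.inv.mul hb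
  have hf : ContMDiffAt 𝓘(ℝ, B) 𝓘(ℝ, E) ∞ (fun y' => (a y)⁻¹ * a y') y :=
    contMDiffAt_const.mul ha
  have h1 := modelDeriv_mul E (hf.mdifferentiableAt (by simp))
    (hk.mdifferentiableAt (by simp)) (by simp) (by simp [hab])
  have h2 : (fun y' => (a y)⁻¹ * a y' * ((a y')⁻¹ * b y')) = fun y' => (b y)⁻¹ * b y' := by
    ext y'
    rw [hab]
    group
  rw [h2] at h1
  have h3 : logDeriv B E b y v - logDeriv B E a y v =
      modelDeriv 𝓘(ℝ, B) 𝓘(ℝ, E) (fun y' => (a y')⁻¹ * b y') y v :=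
    sub_eq_of_eq_add' (DFunLike.congr_fun h1 v)
  exact h3 ▸ modelDeriv_mem_lieSubspace E hk (by simp [hab]) hK v

lemma logDeriv_comp {A : Type*} [TopologicalSpace A] [ChartedSpace B' A] {a : Y → G} {f : A → Y}
    {x : A} (ha : MDifferentiableAt 𝓘(ℝ, B) 𝓘(ℝ, E) a (f x))
    (hf : MDifferentiableAt 𝓘(ℝ, B') 𝓘(ℝ, B) f x) (v : B') :
    logDeriv B' E (fun x' => a (f x')) x v =
      logDeriv B E a (f x) (modelDeriv 𝓘(ℝ, B') 𝓘(ℝ, B) f x v) :=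
  DFunLike.congr_fun (modelDeriv_comp (g := fun y => (a (f x))⁻¹ * a y)
    ((mdifferentiable_const_mul E _ _).comp (f x) ha) hf) v

/-- The comparison is made on the cover `A`, whose charts are known to be smoothly compatible; every
tangent vector at `y` is the image of one at `x`. -/
lemma logDeriv_sub_mem_of_isLocalDiffeomorph {A : Type*} [TopologicalSpace A] [ChartedSpace B A]
    [IsManifold 𝓘(ℝ, B) ∞ A] {p : A → Y} (hp : IsLocalDiffeomorph 𝓘(ℝ, B) 𝓘(ℝ, B) ∞ p)
    {K : Subgroup G} {a b : Y → G} {x : A} {y : Y} (hxy : p x = y)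
    (ha : ContMDiffAt 𝓘(ℝ, B) 𝓘(ℝ, E) ∞ a y) (hb : ContMDiffAt 𝓘(ℝ, B) 𝓘(ℝ, E) ∞ b y)
    (hab : a y = b y) (hK : ∀ᶠ y' in 𝓝 y, (a y')⁻¹ * b y' ∈ K) (v : B) :
    logDeriv B E b y v - logDeriv B E a y v ∈ lieSubspace E K := by
  subst hxy
  have hps := hp.contMDiff x
  have hpx := hps.mdifferentiableAt (by simp)
  let e : B ≃L[ℝ] B := (hp x).mfderivToContinuousLinearEquiv (by simp)
  obtain ⟨w, rfl⟩ := e.surjective v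
  have h := logDeriv_sub_mem E (ha.comp x hps) (hb.comp x hps) hab
    (hps.continuousAt.eventually hK) w
  have h1 := logDeriv_comp E (ha.mdifferentiableAt (by simp)) hpx w
  have h2 := logDeriv_comp E (hb.mdifferentiableAt (by simp)) hpx w
  exact h1 ▸ h2 ▸ h

end LogDeriv

/-! ### The form `D^𝔭` in a local trivialization -/

section FlatBundle

variable {Λ A Y G : Type*} [Group Λ] [TopologicalSpace A] [MulAction Λᵐᵒᵖ A] [TopologicalSpace Y]
  [Group G] [TopologicalSpace G] {p : A → Y} (hp : IsQuotientCoveringMap p Λᵐᵒᵖ) (ρ : Λ →* G)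
  (B E : Type*) [NormedAddCommGroup B] [NormedSpace ℝ B] [NormedAddCommGroup E] [NormedSpace ℝ E]
  [ChartedSpace B A] [ChartedSpace E G] [ContinuousMul G]
  [LieGroup 𝓘(ℝ, E) ∞ G]

/-- The covering `A × G → (A × G) / Λ` is a local diffeomorphism. -/
theorem isLocalDiffeomorph_mk
    (hdeck : ∀ z : Λ, ContMDiff 𝓘(ℝ, B) 𝓘(ℝ, B) ∞ fun x : A => MulOpposite.op z • x) :
    IsLocalDiffeomorph (𝓘(ℝ, B).prod 𝓘(ℝ, E)) (𝓘(ℝ, B).prod 𝓘(ℝ, E)) ∞ (FlatBundle.mk hp ρ) := by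
  refine isLocalDiffeomorph_chartedSpace (FlatBundle.isLocalHomeomorph_mk hp ρ)
    (FlatBundle.surjective_mk hp ρ) ?_
  intro a a' h
  obtain ⟨z, h1, h2⟩ := (FlatBundle.mk_eq_iff hp ρ _ _).1 h
  refine ⟨fun b => (MulOpposite.op z • b.1, (ρ z)⁻¹ * b.2), ?_, Prod.ext h1.symm h2.symm, ?_⟩
  · exact ((hdeck z).comp contMDiff_fst).prodMk (contMDiff_const.mul contMDiff_snd)
  · exact fun b => ((FlatBundle.mk_eq_iff hp ρ _ _).2 ⟨z, rfl, rfl⟩).symm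

variable {hp ρ B} [ChartedSpace B Y]

/-- The flat connection is computed by the logarithmic derivative of the second component of a
local lift to `A × G`. -/
theorem connectionForm_apply
    (hdeck : ∀ z : Λ, ContMDiff 𝓘(ℝ, B) 𝓘(ℝ, B) ∞ fun x : A => MulOpposite.op z • x)
    {y : Y} {σ : Y → A × G} (hσ : MDifferentiableAt 𝓘(ℝ, B) (𝓘(ℝ, B).prod 𝓘(ℝ, E)) σ y)
    {s : Y → FlatBundle hp ρ} (hs : s =ᶠ[𝓝 y] fun y' => FlatBundle.mk hp ρ (σ y')) (v : B) :
    FlatBundle.connectionForm hp ρ B E (s y)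
      (modelDeriv 𝓘(ℝ, B) (𝓘(ℝ, B).prod 𝓘(ℝ, E)) s y v) =
      logDeriv B E (fun y' => (σ y').2) y v := by
  have hmk := isLocalDiffeomorph_mk hp ρ B E hdeck
  -- The connection form is defined through the representative `out`. A deck transformation moves
  -- the lift `σ` to a lift `τ` through that representative.
  obtain ⟨z, h1, h2⟩ := (FlatBundle.mk_eq_iff hp ρ (σ y) (FlatBundle.out hp ρ (s y))).1
    (by rw [FlatBundle.mk_out, hs.self_of_nhds])
  set τ : Y → A × G := fun y' => (MulOpposite.op z • (σ y').1, (ρ z)⁻¹ * (σ y').2) with hτ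
  have hτy : τ y = FlatBundle.out hp ρ (s y) := Prod.ext h1.symm h2.symm
  have hτ2 : MDifferentiableAt 𝓘(ℝ, B) 𝓘(ℝ, E) (fun y' => (τ y').2) y :=
    (mdifferentiable_const_mul E ((ρ z)⁻¹) _).comp y hσ.snd
  have hτ1 : MDifferentiableAt 𝓘(ℝ, B) 𝓘(ℝ, B) (fun y' => (τ y').1) y :=
    ((hdeck z).mdifferentiable (by simp) _).comp y hσ.fst
  have hτd : MDifferentiableAt 𝓘(ℝ, B) (𝓘(ℝ, B).prod 𝓘(ℝ, E)) τ y := hτ1.prodMk hτ2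
  have hsτ : s =ᶠ[𝓝 y] fun y' => FlatBundle.mk hp ρ (τ y') := by
    filter_upwards [hs] with y' hy'
    rw [hy']
    exact (FlatBundle.mk_eq_iff hp ρ _ _).2 ⟨z, rfl, rfl⟩
  obtain ⟨D, hD⟩ : ∃ D : (B × E) →L[ℝ] (B × E), D = modelDeriv (𝓘(ℝ, B).prod 𝓘(ℝ, E))
    (𝓘(ℝ, B).prod 𝓘(ℝ, E)) (FlatBundle.mk hp ρ) (FlatBundle.out hp ρ (s y)) := ⟨_, rfl⟩
  have hDinv : ∀ w, D.inverse (D w) = w := by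
    intro w
    let e : (B × E) ≃L[ℝ] (B × E) :=
      (hmk (FlatBundle.out hp ρ (s y))).mfderivToContinuousLinearEquiv (by simp)
    have he : D = (e : (B × E) →L[ℝ] (B × E)) := hD
    rw [he, ContinuousLinearMap.inverse_equiv]
    exact e.symm_apply_apply w
  have h3 : modelDeriv 𝓘(ℝ, B) (𝓘(ℝ, B).prod 𝓘(ℝ, E)) s y =
      D ∘L modelDeriv 𝓘(ℝ, B) (𝓘(ℝ, B).prod 𝓘(ℝ, E)) τ y := by
    rw [modelDeriv_congr hsτ, hD, ← hτy]
    exact modelDeriv_comp (hmk.mdifferentiable (by simp) _) hτd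
  have h4 : (modelDeriv 𝓘(ℝ, B) (𝓘(ℝ, B).prod 𝓘(ℝ, E)) τ y v).2 =
      modelDeriv 𝓘(ℝ, B) 𝓘(ℝ, E) (fun y' => (τ y').2) y v := by
    have h5 : modelDeriv 𝓘(ℝ, B) (𝓘(ℝ, B).prod 𝓘(ℝ, E)) τ y = _ := modelDeriv_prodMk hτ1 hτ2
    rw [h5]
    rfl
  -- The second components of `σ` and `τ` differ by a constant left factor, invisible to the
  -- logarithmic derivative.
  have h5 : logDeriv B E (fun y' => (σ y').2) y v = maurerCartan E (τ y).2
      (modelDeriv 𝓘(ℝ, B) 𝓘(ℝ, E) (fun y' => (τ y').2) y v) := by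
    rw [← logDeriv_eq_maurerCartan E hτ2]
    exact DFunLike.congr_fun (logDeriv_const_mul E (fun y' => (σ y').2) (ρ z)⁻¹ y).symm v
  rw [h5, h3, ← h4, hτy]
  have h6 : FlatBundle.connectionForm hp ρ B E (s y) = (maurerCartan E
    (FlatBundle.out hp ρ (s y)).2 : E →L[ℝ] E) ∘L ContinuousLinearMap.snd ℝ B E ∘L D.inverse := by
    rw [hD]; rfl
  rw [h6]
  exact congrArg (fun w : B × E => (maurerCartan E (FlatBundle.out hp ρ (s y)).2 : E →L[ℝ] E) w.2)
    (hDinv _)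

end FlatBundle

/-! ### The form `D^𝔭` as a logarithmic derivative modulo `𝔨` -/

section PForm

/-- Complementarity excludes the default value `0` in the definition of `projP`, leaving the
projection with kernel `𝔨`. -/
lemma projP_eq_zero_iff {E : Type*} [NormedAddCommGroup E] [NormedSpace ℝ E] [CompleteSpace E]
    {G : Type*} [TopologicalSpace G] [ChartedSpace E G] [Group G] [LieGroup 𝓘(ℝ, E) ∞ G]
    {K : Subgroup G} (h : IsCompl (cartanP E K) (lieSubspace E K))
    (v : GroupLieAlgebra 𝓘(ℝ, E) G) : projP E K v = 0 ↔ v ∈ lieSubspace E K := by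
  rw [projP, dif_pos h, Submodule.projectionOnto_apply_eq_zero_iff]

lemma projP_eq_of_sub_mem {E : Type*} [NormedAddCommGroup E] [NormedSpace ℝ E] [CompleteSpace E]
    {G : Type*} [TopologicalSpace G] [ChartedSpace E G] [Group G] [LieGroup 𝓘(ℝ, E) ∞ G]
    {K : Subgroup G} (h : IsCompl (cartanP E K) (lieSubspace E K))
    {v w : GroupLieAlgebra 𝓘(ℝ, E) G} (hvw : v - w ∈ lieSubspace E K) :
    projP E K v = projP E K w := by
  rw [← sub_eq_zero, ← map_sub]
  exact (projP_eq_zero_iff h _).2 hvw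

variable {Λ A Y G : Type*} [Group Λ] [TopologicalSpace A] [MulAction Λᵐᵒᵖ A] [TopologicalSpace Y]
  [Group G] [TopologicalSpace G] {p : A → Y} {hp : IsQuotientCoveringMap p Λᵐᵒᵖ} {ρ : Λ →* G}
  {B E : Type*} [NormedAddCommGroup B] [NormedSpace ℂ B] [NormedAddCommGroup E] [NormedSpace ℝ E]
  [CompleteSpace E] [ChartedSpace B A] [ChartedSpace B Y] [ChartedSpace E G] [ContinuousMul G]
  [LieGroup 𝓘(ℝ, E) ∞ G] {K : Subgroup G} {R : Set (FlatBundle hp ρ)}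

/-- Deck transformations of a smooth covering are smooth. -/
lemma contMDiff_deck (hp : IsQuotientCoveringMap p Λᵐᵒᵖ)
    (hpd : IsLocalDiffeomorph 𝓘(ℝ, B) 𝓘(ℝ, B) ∞ p) (z : Λ) :
    ContMDiff 𝓘(ℝ, B) 𝓘(ℝ, B) ∞ fun x : A => MulOpposite.op z • x := by
  intro x
  have hpx : p (MulOpposite.op z • x) = p x := hp.map_smul _
  have hz := hpd (MulOpposite.op z • x)
  -- Near `x` the deck transformation is `p` followed by the local inverse of `p` at the translated
  -- point.
  have hL : ContMDiffAt 𝓘(ℝ, B) 𝓘(ℝ, B) ∞ (fun x' => hz.localInverse (p x')) x := by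
    refine ContMDiffAt.comp x (I' := 𝓘(ℝ, B)) ?_ (hpd.contMDiff x)
    rw [← hpx]
    exact hz.localInverse_contMDiffAt
  refine hL.congr_of_eventuallyEq ?_
  refine eventuallyEq_of_comp_eventuallyEq hp.isCoveringMap.isLocalHomeomorph
    (hp.continuous_const_smul _).continuousAt hL.continuousAt ?_ ?_
  · rw [← hpx]
    exact (hz.localInverse_left_inv hz.localInverse_mem_target).symm
  · have h1 : hz.localInverse.source ∈ 𝓝 (p x) := by
      rw [← hpx]
      exact hz.localInverse_open_source.mem_nhds hz.localInverse_mem_source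
    filter_upwards [hpd.contMDiff.continuous.continuousAt h1] with x' hx'
    rw [hz.localInverse_right_inv hx']
    exact hp.map_smul _

/-- The form `D^𝔭` is the `𝔭`-part of the logarithmic derivative of the second component of a local
lift to `A × G` of a section of the reduction. -/
theorem pForm_apply (hcompl : IsCompl (cartanP E K) (lieSubspace E K)) [IsManifold 𝓘(ℝ, B) ∞ A]
    (hpd : IsLocalDiffeomorph 𝓘(ℝ, B) 𝓘(ℝ, B) ∞ p)
    (htrans : ∀ z ∈ R, ∀ z' ∈ R, FlatBundle.proj hp ρ z = FlatBundle.proj hp ρ z' →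
      ∃ k ∈ K, z' = FlatBundle.act hp ρ k z)
    {U : Set Y} (hU : IsOpen U) {y : Y} (hy : y ∈ U) {σ : Y → A × G}
    (hσ : ContMDiffOn 𝓘(ℝ, B) (𝓘(ℝ, B).prod 𝓘(ℝ, E)) ∞ σ U)
    (hσp : ∀ y' ∈ U, p (σ y').1 = y') (hσR : ∀ y' ∈ U, FlatBundle.mk hp ρ (σ y') ∈ R)
    {z : FlatBundle.Fiber hp ρ R y} (hz : FlatBundle.mk hp ρ (σ y) = z.1) (v : B) :
    pForm hp ρ B E K R y z v = projP E K (logDeriv B E (fun y' => (σ y').2) y v) := by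
  have hdeck := contMDiff_deck hp hpd
  have hmk := isLocalDiffeomorph_mk hp ρ B E hdeck
  have hσy : ContMDiffAt 𝓘(ℝ, B) (𝓘(ℝ, B).prod 𝓘(ℝ, E)) ∞ σ y := hσ.contMDiffAt (hU.mem_nhds hy)
  have hex : ∃ s : Y → FlatBundle hp ρ, FlatBundle.IsLocalSection hp ρ B E R y s ∧ s y = z.1 :=
    ⟨fun y' => FlatBundle.mk hp ρ (σ y'), ⟨U, hU, hy, hmk.contMDiff.comp_contMDiffOn hσ,
      fun y' hy' => ⟨hσR y' hy', hσp y' hy'⟩⟩, hz⟩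
  rw [pForm, dif_pos hex]
  obtain ⟨⟨W, hW, hyW, hsW, hsR⟩, hsy⟩ := hex.choose_spec
  -- The section `s` chosen in `pForm` need not be the one given by `σ`; the two only agree at `y`.
  set s := hex.choose with hs
  have hss : ContMDiffAt 𝓘(ℝ, B) (𝓘(ℝ, B).prod 𝓘(ℝ, E)) ∞ s y := hsW.contMDiffAt (hW.mem_nhds hyW)
  -- a local lift of `s`
  have hmkσ := hmk (σ y)
  set τ : Y → A × G := fun y' => hmkσ.localInverse (s y') with hτ
  have hsyσ : s y = FlatBundle.mk hp ρ (σ y) := by rw [hsy, hz]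
  have hτy : τ y = σ y := by
    rw [hτ]
    simp only [hsyσ]
    exact hmkσ.localInverse_left_inv hmkσ.localInverse_mem_target
  have hτs : ContMDiffAt 𝓘(ℝ, B) (𝓘(ℝ, B).prod 𝓘(ℝ, E)) ∞ τ y := by
    refine ContMDiffAt.comp y (I' := 𝓘(ℝ, B).prod 𝓘(ℝ, E)) ?_ hss
    rw [hsyσ]
    exact hmkσ.localInverse_contMDiffAt
  have hsτ : s =ᶠ[𝓝 y] fun y' => FlatBundle.mk hp ρ (τ y') := by
    have h1 : hmkσ.localInverse.source ∈ 𝓝 (s y) := by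
      rw [hsyσ]
      exact hmkσ.localInverse_open_source.mem_nhds hmkσ.localInverse_mem_source
    filter_upwards [hss.continuousAt h1] with y' hy'
    exact (hmkσ.localInverse_right_inv hy').symm
  have hpl : IsLocalHomeomorph p := hp.isCoveringMap.isLocalHomeomorph
  -- Both first components lift the identity of `Y` through `p` and agree at `y`.
  have hστ1 : (fun y' => (σ y').1) =ᶠ[𝓝 y] fun y' => (τ y').1 := by
    refine eventuallyEq_of_comp_eventuallyEq hpl hσy.continuousAt.fst hτs.continuousAt.fst
      (by rw [hτy]) ?_
    filter_upwards [hsτ, hU.mem_nhds hy, hW.mem_nhds hyW] with y' h1 h2 h3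
    rw [hσp y' h2, ← FlatBundle.proj_mk hp ρ (τ y'), ← h1, (hsR y' h3).2]
  have hK : ∀ᶠ y' in 𝓝 y, ((σ y').2)⁻¹ * (τ y').2 ∈ K := by
    filter_upwards [hsτ, hU.mem_nhds hy, hW.mem_nhds hyW, hστ1] with y' h1 h2 h3 h4
    obtain ⟨k, hk, hsk⟩ := htrans _ (hσR y' h2) _ (hsR y' h3).1
      (by rw [(hsR y' h3).2, FlatBundle.proj_mk, hσp y' h2])
    rw [h1, FlatBundle.act_mk, eq_comm, FlatBundle.mk_eq_iff] at hsk
    obtain ⟨w, hw1, hw2⟩ := hsk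
    -- The first components agree, so freeness of the deck action leaves only the factor `k ∈ K`
    -- between the second components.
    have hw : MulOpposite.op w = 1 :=
      hp.isCancelSMul.right_cancel _ _ (σ y').1 (by
        rw [one_smul]; exact (h4.trans hw1).symm)
    obtain rfl : w = 1 := MulOpposite.op_injective hw
    simp only [map_one, inv_one, one_mul] at hw2
    rw [hw2, inv_mul_cancel_left]
    exact hk
  have h1 := connectionForm_apply E hdeck (hτs.mdifferentiableAt (by simp)) hsτ v
  have h2 := logDeriv_sub_mem_of_isLocalDiffeomorph E hpd (hσp y hy) hσy.snd hτs.snd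
    (by rw [hτy]) hK v
  have h3 : projP E K (FlatBundle.connectionForm hp ρ B E (s y)
      (modelDeriv 𝓘(ℝ, B) (𝓘(ℝ, B).prod 𝓘(ℝ, E)) s y v)) =
      projP E K (logDeriv B E (fun y' => (σ y').2) y v) := by
    rw [h1]
    exact projP_eq_of_sub_mem hcompl h2
  exact h3

end PForm

/-! ### The universal bundle -/

section Universal

variable {E F : Type*} [NormedAddCommGroup E] [NormedSpace ℝ E] [FiniteDimensional ℝ E]
  {G : Type*} [Group G] [TopologicalSpace G] [ChartedSpace E G] [LieGroup 𝓘(ℝ, E) ∞ G]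
  [NormedAddCommGroup F] [NormedSpace ℂ F] [FiniteDimensional ℂ F] {K Γ : Subgroup G}
  [ChartedSpace F (RightCosets K)]

/-- Smooth local sections of `G → K\G`. -/
lemma exists_section_rightCosets (hKG : IsInvariantComplexStructure E F K) (g : G) :
    ∃ (τ : RightCosets K → G) (U : Set (RightCosets K)), IsOpen U ∧ RightCosets.mk K g ∈ U ∧
      ContMDiffOn 𝓘(ℝ, F) 𝓘(ℝ, E) ∞ τ U ∧ τ (RightCosets.mk K g) = g ∧
      ∀ m ∈ U, RightCosets.mk K (τ m) = m := by
  have := isManifold_real_of_complex hKG.isManifold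
  have : IsManifold 𝓘(ℝ, E) ∞ G := ContMDiffMul.toIsManifold
  have : FiniteDimensional ℝ F := FiniteDimensional.complexToReal F
  exact exists_contMDiffOn_section hKG.contMDiff_mk g (hKG.surjective_mfderiv_mk g)

variable [IsTopologicalGroup G] [T2Space G]

/-- Through a smooth local section of `G → K\G`, the action is right multiplication in `G` followed
by the projection. -/
lemma contMDiff_smul_rightCosets (hKG : IsInvariantComplexStructure E F K) (a : Gᵐᵒᵖ) :
    ContMDiff 𝓘(ℝ, F) 𝓘(ℝ, F) ∞ fun m : RightCosets K => a • m := by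
  intro m
  obtain ⟨g, rfl⟩ := (isOpenQuotientMap_rightCosets K).surjective m
  obtain ⟨τ, U, hU, hgU, hτ, -, hτU⟩ := exists_section_rightCosets hKG g
  have h1 : ContMDiffAt 𝓘(ℝ, F) 𝓘(ℝ, F) ∞ (fun m => RightCosets.mk K (τ m * a.unop))
      (RightCosets.mk K g) :=
    hKG.contMDiff_mk.contMDiffAt.comp _ ((hτ.contMDiffAt (hU.mem_nhds hgU)).mul contMDiffAt_const)
  refine h1.congr_of_eventuallyEq ?_
  filter_upwards [hU.mem_nhds hgU] with m hm
  rw [← RightCosets.smul_mk, hτU m hm]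

variable [CompactSpace K] [DiscreteTopology Γ] [TorsionFree Γ]

/-- The covering `K\G → K\G/Γ` is a local diffeomorphism. -/
theorem isLocalDiffeomorph_doubleCosets (hKG : IsInvariantComplexStructure E F K) :
    IsLocalDiffeomorph 𝓘(ℝ, F) 𝓘(ℝ, F) ∞ (DoubleCosets.mk K Γ) := by
  have hq := isQuotientCoveringMap_doubleCosets K Γ
  refine isLocalDiffeomorph_chartedSpace hq.isCoveringMap.isLocalHomeomorph hq.surjective ?_
  intro m m' h
  obtain ⟨γ, hγ⟩ := hq.apply_eq_iff_mem_orbit.1 h.symm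
  exact ⟨fun x => γ • x, contMDiff_smul_rightCosets hKG (MulOpposite.op (γ.unop : G)), hγ,
    fun x => hq.map_smul _⟩

/-- Points over the same double coset satisfy `g'⁻¹ = k g⁻¹ γ`, that is `g' = γ⁻¹ g k⁻¹`. The left
factor `γ⁻¹` is absorbed by the quotient, so `k⁻¹` carries one point to the other. -/
lemma transitive_universalReduction (z : UniversalBundle K Γ) (hz : z ∈ universalReduction K Γ)
    (z' : UniversalBundle K Γ) (hz' : z' ∈ universalReduction K Γ)
    (h : FlatBundle.proj _ Γ.subtype z = FlatBundle.proj _ Γ.subtype z') :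
    ∃ k ∈ K, z' = FlatBundle.act _ Γ.subtype k z := by
  obtain ⟨g, rfl⟩ := hz
  obtain ⟨g', rfl⟩ := hz'
  obtain ⟨γ, hγ⟩ := (isQuotientCoveringMap_doubleCosets K Γ).apply_eq_iff_mem_orbit.1 h.symm
  have hγ' : RightCosets.mk K (g⁻¹ * (γ.unop : G)) = RightCosets.mk K g'⁻¹ := hγ
  obtain ⟨k, hk, hkg⟩ := (RightCosets.mk_eq_iff K _ _).1 hγ'
  refine ⟨k⁻¹, K.inv_mem hk, ?_⟩
  rw [FlatBundle.act_mk, eq_comm, FlatBundle.mk_eq_iff]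
  refine ⟨γ.unop, hγ.symm, ?_⟩
  rw [← inv_inv g', hkg]
  simp [mul_assoc]

variable [CompleteSpace E]

/-- A local description of the universal bundle: near `M`, the tautological lift of points of
`K\G/Γ` to `G` computes the form `D^𝔭`. -/
theorem exists_lift_universal (hKG : IsInvariantComplexStructure E F K)
    (hcompl : IsCompl (cartanP E K) (lieSubspace E K)) {M : DoubleCosets K Γ}
    (z : FlatBundle.Fiber (isQuotientCoveringMap_doubleCosets K Γ) Γ.subtype
      (universalReduction K Γ) M) {g : G} (hz : z.1 = FlatBundle.mk _ _ (RightCosets.mk K g⁻¹, g)) :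
    ∃ b : DoubleCosets K Γ → G, ContMDiffAt 𝓘(ℝ, F) 𝓘(ℝ, E) ∞ b M ∧ b M = g ∧
      (∀ᶠ M' in 𝓝 M, DoubleCosets.mk K Γ (RightCosets.mk K (b M')⁻¹) = M') ∧
      ∀ u : F, pForm _ _ F E K _ M z u = projP E K (logDeriv F E b M u) := by
  have := isManifold_real_of_complex hKG.isManifold
  have hq := isLocalDiffeomorph_doubleCosets (Γ := Γ) hKG
  have hM : DoubleCosets.mk K Γ (RightCosets.mk K g⁻¹) = M := by
    rw [← z.2.2, hz]; rfl
  subst hM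
  -- The lift `b` is the inverse of `τ` composed with a local inverse of `K\G → K\G/Γ`. The section
  -- passes through `g⁻¹`, which gives `b M = g`.
  obtain ⟨τ, W, hW, hgW, hτ, hτg, hτW⟩ := exists_section_rightCosets hKG g⁻¹
  have hL := hq (RightCosets.mk K g⁻¹)
  have hLM : hL.localInverse (DoubleCosets.mk K Γ (RightCosets.mk K g⁻¹)) = RightCosets.mk K g⁻¹ :=
    hL.localInverse_left_inv hL.localInverse_mem_target
  have hLc := hL.localInverse_contMDiffOn
  set U : Set (DoubleCosets K Γ) := hL.localInverse.source ∩ hL.localInverse ⁻¹' W with hU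
  have hUo : IsOpen U := hLc.continuousOn.isOpen_inter_preimage hL.localInverse_open_source hW
  have hMU : DoubleCosets.mk K Γ (RightCosets.mk K g⁻¹) ∈ U := by
    refine ⟨hL.localInverse_mem_source, ?_⟩
    rw [Set.mem_preimage, hLM]
    exact hgW
  have hb : ContMDiffOn 𝓘(ℝ, F) 𝓘(ℝ, E) ∞ (fun M' => (τ (hL.localInverse M'))⁻¹) U :=
    (hτ.comp (hLc.mono Set.inter_subset_left) fun _ h => h.2).inv
  have hbM : (τ (hL.localInverse (DoubleCosets.mk K Γ (RightCosets.mk K g⁻¹))))⁻¹ = g := by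
    rw [hLM, hτg, inv_inv]
  have hrep : ∀ M' ∈ U, RightCosets.mk K ((τ (hL.localInverse M'))⁻¹)⁻¹ = hL.localInverse M' := by
    intro M' hM'
    rw [inv_inv, hτW _ hM'.2]
  have hproj : ∀ M' ∈ U, DoubleCosets.mk K Γ (hL.localInverse M') = M' :=
    fun M' hM' => hL.localInverse_right_inv hM'.1
  refine ⟨fun M' => (τ (hL.localInverse M'))⁻¹, hb.contMDiffAt (hUo.mem_nhds hMU), hbM, ?_, ?_⟩
  · filter_upwards [hUo.mem_nhds hMU] with M' hM'
    rw [hrep M' hM', hproj M' hM']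
  · intro u
    refine pForm_apply (σ := fun M' => (hL.localInverse M', (τ (hL.localInverse M'))⁻¹)) hcompl hq
      transitive_universalReduction hUo hMU ((hLc.mono Set.inter_subset_left).prodMk hb) hproj
      ?_ ?_ u
    · intro M' hM'
      exact ⟨(τ (hL.localInverse M'))⁻¹, congrArg (fun m => FlatBundle.mk
        (isQuotientCoveringMap_doubleCosets K Γ) Γ.subtype (m, (τ (hL.localInverse M'))⁻¹))
        (hrep M' hM')⟩
    · rw [hz, hbM, hLM]

/-- The form `D^𝔭` of the universal bundle is injective on tangent spaces. -/
theorem pForm_universal_injective (hKG : IsInvariantComplexStructure E F K)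
    (hcompl : IsCompl (cartanP E K) (lieSubspace E K)) {M : DoubleCosets K Γ}
    (z : FlatBundle.Fiber (isQuotientCoveringMap_doubleCosets K Γ) Γ.subtype
      (universalReduction K Γ) M) : Function.Injective (pForm _ _ F E K _ M z) := by
  obtain ⟨g, hz⟩ := z.2.1
  obtain ⟨b, hb, hbM, hbU, hbp⟩ := exists_lift_universal hKG hcompl z hz.symm
  refine (injective_iff_map_eq_zero _).2 fun u hu => ?_
  have hu' : logDeriv F E b M u ∈ lieSubspace E K :=
    (projP_eq_zero_iff hcompl _).1 ((hbp u).symm.trans hu)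
  have hq := isLocalDiffeomorph_doubleCosets (Γ := Γ) hKG
  -- The orbit map `h ↦ K h⁻¹ g⁻¹ Γ` is constant along curves in `K`, so its differential at `1`
  -- kills `𝔨`. It also recovers `M'` from `(b M)⁻¹ * b M'`.
  set φ : G → DoubleCosets K Γ := fun h =>
    DoubleCosets.mk K Γ (RightCosets.mk K (h⁻¹ * g⁻¹)) with hφ
  have hφs : ContMDiff 𝓘(ℝ, E) 𝓘(ℝ, F) ∞ φ :=
    hq.contMDiff.comp (hKG.contMDiff_mk.comp
      ((contMDiff_id.inv : ContMDiff 𝓘(ℝ, E) 𝓘(ℝ, E) ∞ fun h : G => h⁻¹).mul contMDiff_const))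
  have hφ0 : ∀ v ∈ lieSubspace E K, modelDeriv 𝓘(ℝ, E) 𝓘(ℝ, F) φ 1 v = 0 := by
    intro v hv
    refine (Submodule.span_le (p := (LinearMap.ker
      (modelDeriv 𝓘(ℝ, E) 𝓘(ℝ, F) φ 1).toLinearMap : Submodule ℝ E))).2 ?_ hv
    rintro v ⟨c, hc0, hc, hcK, rfl⟩
    have h1 : modelDeriv 𝓘(ℝ, ℝ) 𝓘(ℝ, F) (fun t => φ (c t)) 0 =
        modelDeriv 𝓘(ℝ, E) 𝓘(ℝ, F) φ (c 0) ∘L modelDeriv 𝓘(ℝ, ℝ) 𝓘(ℝ, E) c 0 :=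
      modelDeriv_comp (hφs.mdifferentiable (by simp) _) (hc.mdifferentiableAt (by simp))
    have h2 : (fun t => φ (c t)) =ᶠ[𝓝 0] fun _ => DoubleCosets.mk K Γ (RightCosets.mk K g⁻¹) := by
      filter_upwards [hcK] with t ht
      exact congrArg _ ((RightCosets.mk_eq_iff K _ _).2 ⟨c t, ht, by group⟩)
    rw [modelDeriv_congr h2, hc0] at h1
    have h3 : modelDeriv 𝓘(ℝ, ℝ) 𝓘(ℝ, F) (fun _ : ℝ => DoubleCosets.mk K Γ (RightCosets.mk K g⁻¹)) 0
      = 0 := mfderiv_const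
    rw [h3] at h1
    exact (DFunLike.congr_fun h1 (1 : ℝ)).symm
  have h1 : (fun M' => φ ((b M)⁻¹ * b M')) =ᶠ[𝓝 M] fun M' => M' := by
    filter_upwards [hbU] with M' hM'
    rw [hφ]
    simp only [hbM, mul_inv_rev, inv_inv, mul_assoc, mul_inv_cancel, mul_one]
    exact hM'
  have hbd : MDifferentiableAt 𝓘(ℝ, F) 𝓘(ℝ, E) (fun M' => (b M)⁻¹ * b M') M :=
    (mdifferentiable_const_mul E _ _).comp M (hb.mdifferentiableAt (by simp))
  -- The chain rule expresses the identity of the tangent space at `M` as `dφ` after the logarithmic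
  -- derivative of `b`; hence `u = dφ(logDeriv u) = 0`.
  have h2 : modelDeriv 𝓘(ℝ, F) 𝓘(ℝ, F) (fun M' => φ ((b M)⁻¹ * b M')) M =
      modelDeriv 𝓘(ℝ, E) 𝓘(ℝ, F) φ ((b M)⁻¹ * b M) ∘L logDeriv F E b M :=
    modelDeriv_comp (hφs.mdifferentiable (by simp) _) hbd
  rw [modelDeriv_congr h1, modelDeriv_id, inv_mul_cancel] at h2
  exact (DFunLike.congr_fun h2 u).trans (hφ0 _ hu')

end Universal

/-! ### The classifying map -/

/-! ### The identity `ω = -D^𝔭 ∘ J` -/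

section Omega

/-- Taking the real part in the factor `ℂ` is a left inverse. -/
lemma one_tmul_injective (W : Type*) [AddCommGroup W] [Module ℝ W] :
    Function.Injective fun w : W => (1 : ℂ) ⊗ₜ[ℝ] w := by
  intro w w' h
  simpa using congrArg (fun t => TensorProduct.lid ℝ W (LinearMap.rTensor W Complex.reLm t)) h

/-- In the difference the terms `1 ⊗ η v` cancel and those with `η (J v)` add up to `-(i ⊗ η (J
v))`; division by `i` makes the result real. -/
lemma type10_sub_type01 {T W : Type*} [AddCommGroup T] [Module ℝ T] [AddCommGroup W] [Module ℝ W]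
    (J : T →ₗ[ℝ] T) (η : T →ₗ[ℝ] W) (v : T) :
    ((1 / Complex.I) • (type10 J η - type01 J η)) v = -((1 : ℂ) ⊗ₜ[ℝ] η (J v)) := by
  simp only [type10, type01, LinearMap.smul_apply, LinearMap.sub_apply, LinearMap.add_apply,
    LinearMap.comp_apply, TensorProduct.mk_apply, ← smul_sub]
  have h (a b : ℂ ⊗[ℝ] W) : a - b - (a + b) = (-2 : ℂ) • b := by
    rw [neg_smul, two_smul]
    abel
  rw [h, TensorProduct.smul_tmul', TensorProduct.smul_tmul', TensorProduct.smul_tmul',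
    ← TensorProduct.neg_tmul]
  congr 1
  simp only [smul_eq_mul]
  field_simp

lemma neg_one_tmul_eq_neg_iff {T W : Type*} [AddCommGroup T] [Module ℝ T] [AddCommGroup W]
    [Module ℝ W] {η : T →ₗ[ℝ] W} (hη : Function.Injective η) {a b : T} :
    -((1 : ℂ) ⊗ₜ[ℝ] η a) = - -((1 : ℂ) ⊗ₜ[ℝ] η b) ↔ b = -a := by
  rw [neg_inj, ← TensorProduct.tmul_neg, (one_tmul_injective W).eq_iff, ← map_neg, hη.eq_iff,
    eq_comm, neg_eq_iff_eq_neg]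

lemma omegaForm_apply {Λ A Y G : Type*} [Group Λ] [TopologicalSpace A] [MulAction Λᵐᵒᵖ A]
    [TopologicalSpace Y] [Group G] [TopologicalSpace G] {p : A → Y}
    {hp : IsQuotientCoveringMap p Λᵐᵒᵖ} {ρ : Λ →* G} {B E : Type*} [NormedAddCommGroup B]
    [NormedSpace ℂ B] [NormedAddCommGroup E] [NormedSpace ℝ E] [CompleteSpace E] [ChartedSpace B A]
    [ChartedSpace B Y] [ChartedSpace E G] [ContinuousMul G] [LieGroup 𝓘(ℝ, E) ∞ G] {K : Subgroup G}
    {R : Set (FlatBundle hp ρ)} (y : Y) (z : FlatBundle.Fiber hp ρ R y)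
    (v : TangentSpace 𝓘(ℝ, B) y) :
    omegaForm hp ρ B E K R y z v = -((1 : ℂ) ⊗ₜ[ℝ] pForm hp ρ B E K R y z (tangentJ y v)) :=
  type10_sub_type01 _ _ _

end Omega

/-! ### Naturality of `D^𝔭` under `H_D`, and the pointwise criteria -/

section Classifying

variable {E B F : Type*} [NormedAddCommGroup E] [NormedSpace ℝ E] [FiniteDimensional ℝ E]
  [CompleteSpace E] {G : Type*} [Group G] [TopologicalSpace G] [ChartedSpace E G]
  [LieGroup 𝓘(ℝ, E) ∞ G] [IsTopologicalGroup G] [T2Space G]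
  [NormedAddCommGroup F] [NormedSpace ℂ F] [FiniteDimensional ℂ F] {K Γ : Subgroup G}
  [CompactSpace K] [DiscreteTopology Γ] [TorsionFree Γ] [ChartedSpace F (RightCosets K)]
  [NormedAddCommGroup B] [NormedSpace ℂ B]
  {Λ A Y : Type*} [Group Λ] [TopologicalSpace A] [MulAction Λᵐᵒᵖ A] [TopologicalSpace Y]
  [ChartedSpace B A] [ChartedSpace B Y] {p : A → Y} {hp : IsQuotientCoveringMap p Λᵐᵒᵖ}
  {ρ : Λ →* Γ} {R : Set (RepBundle Γ hp ρ)}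

/-- The classifying map is smooth, and pulls the form `D^𝔭` of the universal bundle back to that
of the given flat bundle. -/
theorem pForm_classifyingMap (hKG : IsInvariantComplexStructure E F K)
    (hcompl : IsCompl (cartanP E K) (lieSubspace E K)) [IsManifold 𝓘(ℝ, B) ∞ A]
    (hpd : IsLocalDiffeomorph 𝓘(ℝ, B) 𝓘(ℝ, B) ∞ p)
    (hR : FlatBundle.IsReduction hp (Γ.subtype.comp ρ) B E K R) (y : Y)
    (z : FlatBundle.Fiber hp (Γ.subtype.comp ρ) R y) :
    MDifferentiableAt 𝓘(ℝ, B) 𝓘(ℝ, F) (classifyingMap K hp ρ R) y ∧ ∀ v : B,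
      pForm _ _ F E K _ (classifyingMap K hp ρ R y) (fiberMap hp ρ hR y z)
        (modelDeriv 𝓘(ℝ, B) 𝓘(ℝ, F) (classifyingMap K hp ρ R) y v) =
      pForm hp (Γ.subtype.comp ρ) B E K R y z v := by
  have hdeck := contMDiff_deck hp hpd
  have hmk := isLocalDiffeomorph_mk hp (Γ.subtype.comp ρ) B E hdeck
  obtain ⟨z, hzR, rfl⟩ := z
  obtain ⟨s, ⟨W, hW, hyW, hs, hsR⟩, hsy⟩ := hR.exists_section z hzR
  obtain ⟨⟨x, g⟩, rfl⟩ := FlatBundle.surjective_mk hp (Γ.subtype.comp ρ) z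
  set y := FlatBundle.proj hp (Γ.subtype.comp ρ) (FlatBundle.mk hp (Γ.subtype.comp ρ) (x, g))
  have hL := hmk (x, g)
  -- A section of the reduction lifted to `A × G`; its second component is the local map to `G`
  -- which computes both `H_D` and `D^𝔭`.
  set σ : Y → A × G := fun y' => hL.localInverse (s y') with hσ
  have hσy : σ y = (x, g) := by
    rw [hσ]
    simp only [hsy]
    exact hL.localInverse_left_inv hL.localInverse_mem_target
  set U : Set Y := W ∩ s ⁻¹' hL.localInverse.source with hU
  have hUo : IsOpen U := hs.continuousOn.isOpen_inter_preimage hW hL.localInverse_open_source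
  have hyU : y ∈ U := ⟨hyW, by rw [Set.mem_preimage, hsy]; exact hL.localInverse_mem_source⟩
  have hσs : ContMDiffOn 𝓘(ℝ, B) (𝓘(ℝ, B).prod 𝓘(ℝ, E)) ∞ σ U :=
    hL.localInverse_contMDiffOn.comp (hs.mono Set.inter_subset_left) fun _ h => h.2
  have hmkσ : ∀ y' ∈ U, FlatBundle.mk hp (Γ.subtype.comp ρ) (σ y') = s y' :=
    fun y' hy' => hL.localInverse_right_inv hy'.2
  have hσR : ∀ y' ∈ U, FlatBundle.mk hp (Γ.subtype.comp ρ) (σ y') ∈ R := fun y' hy' => by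
    rw [hmkσ y' hy']
    exact (hsR y' hy'.1).1
  have hσp : ∀ y' ∈ U, p (σ y').1 = y' := fun y' hy' => by
    rw [← FlatBundle.proj_mk hp (Γ.subtype.comp ρ), hmkσ y' hy', (hsR y' hy'.1).2]
  have hH : ∀ y' ∈ U, classifyingMap K hp ρ R y' =
      DoubleCosets.mk K Γ (RightCosets.mk K ((σ y').2)⁻¹) := fun y' hy' => by
    have h1 := classifyingMap_proj hp ρ hR (hσR y' hy')
    rwa [proj_toUniversal_mk, FlatBundle.proj_mk, hσp y' hy'] at h1
  have hσy' : ContMDiffAt 𝓘(ℝ, B) (𝓘(ℝ, B).prod 𝓘(ℝ, E)) ∞ σ y :=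
    hσs.contMDiffAt (hUo.mem_nhds hyU)
  have hm : ContMDiffAt 𝓘(ℝ, B) 𝓘(ℝ, F) ∞ (fun y' => RightCosets.mk K ((σ y').2)⁻¹) y :=
    hKG.contMDiff_mk.contMDiffAt.comp y hσy'.snd.inv
  have hHs : ContMDiffAt 𝓘(ℝ, B) 𝓘(ℝ, F) ∞ (classifyingMap K hp ρ R) y := by
    refine ((isLocalDiffeomorph_doubleCosets (Γ := Γ) hKG).contMDiff.contMDiffAt.comp y
      hm).congr_of_eventuallyEq ?_
    filter_upwards [hUo.mem_nhds hyU] with y' hy'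
    exact hH y' hy'
  have hHd := hHs.mdifferentiableAt (by simp)
  refine ⟨hHd, fun v => ?_⟩
  obtain ⟨b, hb, hby, hbU, hbp⟩ := exists_lift_universal hKG hcompl
    (fiberMap hp ρ hR y ⟨_, hzR, rfl⟩) (toUniversal_mk hp ρ (x, g))
  have h1 := pForm_apply hcompl hpd hR.transitive hUo hyU hσs hσp hσR
    (z := ⟨_, hzR, rfl⟩) (congrArg _ hσy) v
  have hbH : ContMDiffAt 𝓘(ℝ, B) 𝓘(ℝ, E) ∞ (fun y' => b (classifyingMap K hp ρ R y')) y :=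
    hb.comp y hHs
  -- Both sides are lifts of `H_D` to `K\G` with the same value at `y`, so they agree nearby. Hence
  -- `b ∘ H_D` and the second component of `σ` differ on the right by a `K`-valued map.
  have hlift : (fun y' => RightCosets.mk K (b (classifyingMap K hp ρ R y'))⁻¹) =ᶠ[𝓝 y]
      fun y' => RightCosets.mk K ((σ y').2)⁻¹ := by
    refine eventuallyEq_of_comp_eventuallyEq
      (isQuotientCoveringMap_doubleCosets K Γ).isCoveringMap.isLocalHomeomorph
      ((isOpenQuotientMap_rightCosets K).continuous.continuousAt.comp hbH.continuousAt.inv)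
      hm.continuousAt (by rw [hby, hσy]) ?_
    filter_upwards [hUo.mem_nhds hyU, hHs.continuousAt.eventually hbU] with y' h1 h2
    rw [h2, hH y' h1]
  have hK : ∀ᶠ y' in 𝓝 y, ((σ y').2)⁻¹ * b (classifyingMap K hp ρ R y') ∈ K := by
    filter_upwards [hlift] with y' hy'
    obtain ⟨k, hk, hkb⟩ := (RightCosets.mk_eq_iff K _ _).1 hy'
    rw [hkb]
    simpa using hk
  have h2 := logDeriv_sub_mem_of_isLocalDiffeomorph E hpd (hσp y hyU) hσy'.snd hbH
    (by rw [hby, hσy]) hK v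
  rw [logDeriv_comp E (hb.mdifferentiableAt (by simp)) hHd] at h2
  exact (hbp _).trans ((projP_eq_of_sub_mem hcompl h2).trans h1.symm)

/-- The criterion for `H_D` to be holomorphic, at a tangent vector. -/
lemma pullbackForm_apply_eq_iff (hKG : IsInvariantComplexStructure E F K)
    (hcompl : IsCompl (cartanP E K) (lieSubspace E K)) [IsManifold 𝓘(ℝ, B) ∞ A]
    (hpd : IsLocalDiffeomorph 𝓘(ℝ, B) 𝓘(ℝ, B) ∞ p)
    (hR : FlatBundle.IsReduction hp (Γ.subtype.comp ρ) B E K R)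
    (y : Y) (z : FlatBundle.Fiber hp (Γ.subtype.comp ρ) R y)
    (v : TangentSpace 𝓘(ℝ, B) y) :
    pullbackForm hp ρ hR (universalOmega K Γ E F) y z v =
      omegaForm hp (Γ.subtype.comp ρ) B E K R y z v ↔
    mfderiv 𝓘(ℝ, B) 𝓘(ℝ, F) (classifyingMap K hp ρ R) y (tangentJ y v) =
      tangentJ (classifyingMap K hp ρ R y)
        (mfderiv 𝓘(ℝ, B) 𝓘(ℝ, F) (classifyingMap K hp ρ R) y v) := by
  have h1 : pullbackForm hp ρ hR (universalOmega K Γ E F) y z v = _ := omegaForm_apply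
    (classifyingMap K hp ρ R y) (fiberMap hp ρ hR y z)
    (mfderiv 𝓘(ℝ, B) 𝓘(ℝ, F) (classifyingMap K hp ρ R) y v)
  -- Naturality at `J v` turns both sides into values of the universal `D^𝔭`, which injectivity then
  -- removes.
  have h2 := (pForm_classifyingMap hKG hcompl hpd hR y z).2 (tangentJ y v)
  rw [h1, omegaForm_apply, neg_inj, (one_tmul_injective _).eq_iff, ← h2, eq_comm]
  exact (pForm_universal_injective hKG hcompl (fiberMap hp ρ hR y z)).eq_iff

/-- The criterion for `H_D` to be anti-holomorphic, at a tangent vector. -/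
lemma pullbackForm_apply_eq_neg_iff (hKG : IsInvariantComplexStructure E F K)
    (hcompl : IsCompl (cartanP E K) (lieSubspace E K)) [IsManifold 𝓘(ℝ, B) ∞ A]
    (hpd : IsLocalDiffeomorph 𝓘(ℝ, B) 𝓘(ℝ, B) ∞ p)
    (hR : FlatBundle.IsReduction hp (Γ.subtype.comp ρ) B E K R)
    (y : Y) (z : FlatBundle.Fiber hp (Γ.subtype.comp ρ) R y)
    (v : TangentSpace 𝓘(ℝ, B) y) :
    pullbackForm hp ρ hR (universalOmega K Γ E F) y z v =
      -omegaForm hp (Γ.subtype.comp ρ) B E K R y z v ↔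
    mfderiv 𝓘(ℝ, B) 𝓘(ℝ, F) (classifyingMap K hp ρ R) y (tangentJ y v) =
      -tangentJ (classifyingMap K hp ρ R y)
        (mfderiv 𝓘(ℝ, B) 𝓘(ℝ, F) (classifyingMap K hp ρ R) y v) := by
  have h1 : pullbackForm hp ρ hR (universalOmega K Γ E F) y z v = _ := omegaForm_apply
    (classifyingMap K hp ρ R y) (fiberMap hp ρ hR y z)
    (mfderiv 𝓘(ℝ, B) 𝓘(ℝ, F) (classifyingMap K hp ρ R) y v)
  have h2 := (pForm_classifyingMap hKG hcompl hpd hR y z).2 (tangentJ y v)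
  rw [h1, omegaForm_apply, ← h2]
  exact neg_one_tmul_eq_neg_iff
    (pForm_universal_injective hKG hcompl (fiberMap hp ρ hR y z))

end Classifying

end FlatReduction

/-! ### The main theorem -/

theorem mainTheorem1
    -- a connected noncompact simple real Lie group `G` with trivial center
    {E : Type*} [NormedAddCommGroup E] [NormedSpace ℝ E] [FiniteDimensional ℝ E] [CompleteSpace E]
    {G : Type*} [Group G] [TopologicalSpace G] [ChartedSpace E G] [LieGroup 𝓘(ℝ, E) ∞ G]
    [IsTopologicalGroup G] [T2Space G] [ConnectedSpace G] [NoncompactSpace G]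
    (hsimple : LieAlgebra.IsSimple ℝ (GroupLieAlgebra 𝓘(ℝ, E) G))
    (hcenter : Subgroup.center G = ⊥)
    -- a maximal compact subgroup `K` whose center has positive dimension
    (K : Subgroup G) [CompactSpace K]
    (hK : Maximal (fun K' : Subgroup G => IsCompact (K' : Set G)) K)
    (hKcenter : 0 < Module.finrank ℝ (lieSubspace E ((Subgroup.center K).map K.subtype)))
    -- the Hermitian symmetric space `K\G`
    {F : Type*} [NormedAddCommGroup F] [NormedSpace ℂ F] [FiniteDimensional ℂ F]
    [ChartedSpace F (RightCosets K)] (hKG : IsInvariantComplexStructure E F K)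
    -- a discrete torsionfree subgroup `Γ`
    (Γ : Subgroup G) [DiscreteTopology Γ] [TorsionFree Γ]
    -- a compact connected complex manifold `X` with its universal cover `β : X' → X`
    {V : Type*} [NormedAddCommGroup V] [NormedSpace ℂ V] [FiniteDimensional ℂ V]
    {X : Type*} [TopologicalSpace X] [ChartedSpace V X] [IsManifold 𝓘(ℂ, V) ω X]
    [T2Space X] [CompactSpace X] [ConnectedSpace X] (x₀ : X)
    {X' : Type*} [TopologicalSpace X'] [ChartedSpace V X']
    [MulAction (FundamentalGroup X x₀)ᵐᵒᵖ X'] {β : X' → X} {x₀' : X'}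
    (hβ : IsUniversalCover V x₀ β x₀')
    -- a homomorphism `ρ` and a reduction `EK` of its flat `G`-bundle to `K`
    (ρ : FundamentalGroup X x₀ →* Γ)
    (hρ : AdCompletelyReducible E (Γ.subtype.comp ρ).range)
    (EK : Set (RepBundle Γ hβ.covering ρ))
    (hEK : FlatBundle.IsReduction hβ.covering (Γ.subtype.comp ρ) V E K EK) :
    (MDifferentiable 𝓘(ℂ, V) 𝓘(ℂ, F) (classifyingMap K hβ.covering ρ EK) ↔
      pullbackForm hβ.covering ρ hEK (universalOmega K Γ E F) =
        omegaForm hβ.covering (Γ.subtype.comp ρ) V E K EK) ∧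
    (IsAntiholomorphic (V := V) (F := F) (classifyingMap K hβ.covering ρ EK) ↔
      pullbackForm hβ.covering ρ hEK (universalOmega K Γ E F) =
        -omegaForm hβ.covering (Γ.subtype.comp ρ) V E K EK) := by

  have hcompl := isCompl_cartanP E hsimple K
  have := hβ.isManifold
  have key := pForm_classifyingMap (R := EK) hKG hcompl hβ.isLocalDiffeomorph hEK
  have hne : ∀ y, Nonempty (FlatBundle.Fiber hβ.covering (Γ.subtype.comp ρ) EK y) := fun y => by
    obtain ⟨z, hz, hzy⟩ := hEK.nonempty y
    exact ⟨⟨z, hz, hzy⟩⟩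
  -- Real differentiability holds in all cases, so each equivalence only concerns how `dH_D`
  -- interacts with `J`. Nonempty fibres of the reduction allow equality of forms to be tested at
  -- every point of `X`.
  have hd : MDifferentiable 𝓘(ℝ, V) 𝓘(ℝ, F) (classifyingMap K hβ.covering ρ EK) :=
    fun y => (key y (hne y).some).1
  constructor
  · constructor
    · intro h
      funext y z
      exact LinearMap.ext fun v => (pullbackForm_apply_eq_iff hKG hcompl hβ.isLocalDiffeomorph hEK
        y z v).2 ((mdifferentiableAt_complex_iff.1 (h y)).2 v)
    · intro h y
      obtain ⟨z⟩ := hne y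
      exact mdifferentiableAt_complex_iff.2 ⟨hd y, fun v => (pullbackForm_apply_eq_iff hKG hcompl
        hβ.isLocalDiffeomorph hEK y z v).1 (LinearMap.congr_fun (congrFun (congrFun h y) z) v)⟩
  · constructor
    · intro h
      funext y z
      exact LinearMap.ext fun v => (pullbackForm_apply_eq_neg_iff hKG hcompl
        hβ.isLocalDiffeomorph hEK y z v).2 (h.2 y v)
    · intro h
      refine ⟨hd, fun y v => ?_⟩
      obtain ⟨z⟩ := hne y
      exact (pullbackForm_apply_eq_neg_iff hKG hcompl hβ.isLocalDiffeomorph hEK y z v).1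
        (LinearMap.congr_fun (congrFun (congrFun h y) z) v)
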